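/- Let $T>0$, $\underline v>0$, let $v\in L^\infty(\mathbb R)$ satisfy $v\ge\underline v$ a.e., and let $\lambda\in L^\infty((0,T);W^{1,\infty}(\mathbb R))$, where $\lambda(t,\cdot)$ denotes the continuous representative and $\partial_2\lambda$ the weak derivative in space. For every $x_0\in\mathbb R$ there is a unique $\mathcal X[v,\lambda](x_0;\cdot)\in C([0,T])$ with $$\int_{x_0}^{\mathcal X[v,\lambda](x_0;t)}\frac{1}{v(y)}\,dy=\int_0^t\lambda\big(s,\mathcal X[v,\lambda](x_0;s)\big)\,ds\qquad\text{for all }t\in[0,T],$$ and for every $t\in[0,T]$ the map $x_0\mapsto\mathcal X[v,\lambda](x_0;t)$ has a weak derivative $\partial_{x_0}\mathcal X[v,\lambda](\cdot;t)\in L^1_{\mathrm{loc}}(\mathbb R)$. The map $t\mapsto\partial_{x_0}\mathcal X[v,\lambda](\cdot;t)$ is continuous from $[0,T]$ to $L^1_{\mathrm{loc}}(\mathbb R)$, i.e. for every $\tilde t\in[0,T]$ and every compact $K\subset\mathbb R$, $$\lim_{[0,T]\ni t\to\tilde t}\big\|\partial_{x_0}\mathcal X[v,\lambda](\cdot;t)-\partial_{x_0}\mathcal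 X[v,\lambda](\cdot;\tilde t)\big\|_{L^1(K)}=0.$$ For $\Omega\subset\mathbb R$ let $|v|_{TV(\Omega)}=\sup\{\int_{\mathbb R} v\varphi'\,dy:\varphi\in C^1_c(\mathbb R),\ \operatorname{supp}\varphi\subset\Omega,\ |\varphi|\le1\}$. If in addition $|v|_{TV(K)}<\infty$ for every compact $K\subset\mathbb R$, then, with $$V=\|v\|_{L^\infty(\mathbb R)},\quad \mathcal L=\|\lambda\|_{L^\infty((0,T);L^\infty(\mathbb R))},\quad \mathcal L_2=\|\partial_2\lambda\|_{L^\infty((0,T);L^\infty(\mathbb R))},$$ for all $t,\tilde t\in[0,T]$ and every open bounded $X\subset\mathbb R$ with Lebesgue measure $|X|$, the quantity $|v|_{TV(X+VT\mathcal L\cdot(-1,1))}$ is finite and $$\big\|\partial_{x_0}\mathcal X[v,\lambda](\cdot;t)-\partial_{x_0}\mathcal X[v,\lambda](\cdot;\tilde t)\big\|_{L^1(X)}\le\frac{|t-\tilde t|\,V^2e^{T\mathcal L_2V}}{\underline v}\Big(\mathcal L_2|X|+\frac{\mathcal L}{\underline v}\,e^{T\mathcal L_2V}\,|v|_{TV(X+VT\mathcal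 L\cdot(-1,1))}\Big).$$ -/

import Mathlib

open MeasureTheory Set Filter Topology
open scoped ENNReal Pointwise ContDiff

namespace DiscODE

/-- `g` is the weak derivative of `f` on the whole real line. -/
def HasWeakDeriv (f g : ℝ → ℝ) : Prop :=
  LocallyIntegrable f volume ∧ LocallyIntegrable g volume ∧
    ∀ φ : ℝ → ℝ, ContDiff ℝ ∞ φ → HasCompactSupport φ →
      ∫ y, f y * deriv φ y = -∫ y, g y * φ y

open Classical in
/-- A representative of the (almost everywhere unique) weak derivative of `f`; the zero function
if `f` has no weak derivative. -/
noncomputable def weakDeriv (f : ℝ → ℝ) : ℝ → ℝ :=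
  if h : ∃ g, HasWeakDeriv f g then h.choose else 0

/-- `f` is the continuous representative of an element of the Sobolev space `W^{1,∞}(ℝ)`. -/
def MemW1Infty (f : ℝ → ℝ) : Prop :=
  Continuous f ∧ MemLp f ⊤ volume ∧ ∃ g, HasWeakDeriv f g ∧ MemLp g ⊤ volume

/-- The norm of `f` in `L^∞((0,T); L^∞(ℝ))`, as an extended nonnegative real. -/
noncomputable def eNormLinfLinf (T : ℝ) (f : ℝ → ℝ → ℝ) : ℝ≥0∞ :=
  essSup (fun t => eLpNorm (f t) ⊤ volume) (volume.restrict (Ioo 0 T))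

/-- `lam ∈ L^∞((0,T); W^{1,∞}(ℝ))`, each `lam t` being represented by its continuous
representative.  Measurability in time is only asked of the point evaluations. -/
structure MemLinfW1Infty (T : ℝ) (lam : ℝ → ℝ → ℝ) : Prop where
  measurable : ∀ y, AEStronglyMeasurable (fun t => lam t y) (volume.restrict (Ioo 0 T))
  memW1Infty : ∀ᵐ t ∂(volume.restrict (Ioo 0 T)), MemW1Infty (lam t)
  bounded : eNormLinfLinf T lam < ⊤
  bounded_deriv : eNormLinfLinf T (fun t => weakDeriv (lam t)) < ⊤

/-- `v ∈ L^∞(ℝ; ℝ_{≥ vlow})`. -/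
def MemLinfGe (vlow : ℝ) (v : ℝ → ℝ) : Prop :=
  MemLp v ⊤ volume ∧ ∀ᵐ y, vlow ≤ v y

/-- `x` solves `x' = v(x) lam(t,x)`, `x(0) = x₀` on `[0,T]`, in the integral sense. -/
def IsSolution (T : ℝ) (v : ℝ → ℝ) (lam : ℝ → ℝ → ℝ) (x₀ : ℝ) (x : ℝ → ℝ) : Prop :=
  ContinuousOn x (Icc 0 T) ∧
    ∀ t ∈ Icc 0 T, ∫ y in x₀..x t, 1 / v y = ∫ s in (0 : ℝ)..t, lam s (x s)

open Classical in
/-- The solution `𝒳[v,lam](x₀; ·)` on `[0,T]`; its values outside `[0,T]` are irrelevant. -/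
noncomputable def flow (T : ℝ) (v : ℝ → ℝ) (lam : ℝ → ℝ → ℝ) (x₀ : ℝ) : ℝ → ℝ :=
  if h : ∃ x, IsSolution T v lam x₀ x then h.choose else 0

/-- The derivative `∂_{x₀} 𝒳[v,lam](·; t)` with respect to the initial datum. -/
noncomputable def flowDeriv (T : ℝ) (v : ℝ → ℝ) (lam : ℝ → ℝ → ℝ) (t : ℝ) : ℝ → ℝ :=
  weakDeriv (fun y => flow T v lam y t)

/-- The total variation of (the class of) `v` on `Ω`, defined by duality. -/
noncomputable def totalVar (v : ℝ → ℝ) (Ω : Set ℝ) : ℝ≥0∞ :=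
  ⨆ (φ : ℝ → ℝ) (_ : ContDiff ℝ 1 φ ∧ HasCompactSupport φ ∧ tsupport φ ⊆ Ω ∧ ∀ y, |φ y| ≤ 1),
    ENNReal.ofReal (∫ y, v y * deriv φ y)

/-- `v ∈ TV_loc(ℝ)`. -/
def MemTVloc (v : ℝ → ℝ) : Prop :=
  ∀ K : Set ℝ, IsCompact K → totalVar v K < ⊤

end DiscODE

namespace DiscODE

open scoped NNReal BoundedContinuousFunction

/-! The discontinuous factor `v` is removed by a change of variable. Let `G` be a primitive of `1 /
v`, an increasing bi-Lipschitz bijection. Then `x` is a solution exactly when `z = G ∘ x` satisfies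
z(t) = G(x₀) + ∫₀ᵗ λ(s, G⁻¹(z(s))) ds, and this right-hand side is bounded, measurable in time and
Lipschitz in `z` with constant `L₂ V`. Picard iteration and Grönwall give a unique flow Z_t which is
bi-Lipschitz with constant exp(L₂VT) in both directions; the original flow is a_t = G⁻¹ ∘ Z_t ∘ G.

Since a_t is Lipschitz, its weak derivative is the a.e. derivative v(a_t(x)) Z_t'(G x) / v(x)
(`ae_hasDerivAt_conj`). The difference of two times splits into a part with Z_t' − Z_s', which is
O(|t − s|) because Z_t − Z_s has a small Lipschitz constant (`abs_flow_double_sub_le`), and a part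
with v ∘ a_t − v ∘ a_s, to be measured in L¹.

For merely bounded `v` the second part tends to 0 by approximating `v` by continuous functions,
since the maps a_t push Lebesgue measure to at most a fixed multiple of itself
(`tendsto_lintegral_comp_sub`). For `v` of locally bounded variation one argues by duality: if |ψ| ≤
1 has primitive Ψ, then ∫ (v ∘ a − v ∘ b) ψ = ∫ v φ' with φ = Ψ ∘ a⁻¹ − Ψ ∘ b⁻¹, and |φ| ≤ sup |a⁻¹
− b⁻¹| (`integral_comp_sub_mul_le_totalVar`). As φ is only Lipschitz, the C¹ definition of the
variation is first extended to such test functions (`integral_mul_deriv_le_totalVar`). -/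

/-! ### Weak derivatives and Lipschitz functions. -/

theorem integral_deriv_mul_eq_neg {f g : ℝ → ℝ} {C D : ℝ≥0} (hf : LipschitzWith C f)
    (hg : LipschitzWith D g) (hc : HasCompactSupport g) :
    ∫ y, f y * deriv g y = -∫ y, deriv f y * g y := by
  have h := LipschitzWith.integral_lineDeriv_mul_eq (μ := volume) hf hg hc (1 : ℝ)
  have h1 : ∀ x, lineDeriv ℝ f x 1 = deriv f x := by
    intro x
    have := deriv_comp_const_add f x 0
    simp only [add_zero] at this
    simpa [lineDeriv, smul_eq_mul] using this
  have h2 : ∀ x, lineDeriv ℝ g x (-1) = -deriv g x := by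
    intro x
    rw [lineDeriv_neg]
    have := deriv_comp_const_add g x 0
    simp only [add_zero] at this
    simpa [lineDeriv, smul_eq_mul] using this
  simp only [h1, h2] at h
  rw [h, ← integral_neg]
  congr 1
  ext y
  ring

theorem locallyIntegrable_of_bound {f : ℝ → ℝ} {C : ℝ} (hf : AEStronglyMeasurable f volume)
    (hC : ∀ᵐ y, |f y| ≤ C) : LocallyIntegrable f volume := by
  have : MemLp f ⊤ volume := memLp_top_of_bound hf C (by simpa using hC)
  exact this.locallyIntegrable le_top

theorem hasWeakDeriv_of_lipschitz {f : ℝ → ℝ} {C : ℝ≥0} (hf : LipschitzWith C f) :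
    HasWeakDeriv f (deriv f) := by
  refine ⟨hf.continuous.locallyIntegrable, ?_, ?_⟩
  · exact locallyIntegrable_of_bound (C := C) (measurable_deriv f).aestronglyMeasurable
      (Eventually.of_forall fun y => by simpa using norm_deriv_le_of_lipschitz hf (x₀ := y))
  · intro φ hφ hc
    obtain ⟨D, hD⟩ := ContDiff.lipschitzWith_of_hasCompactSupport hc hφ (by simp)
    exact integral_deriv_mul_eq_neg hf hD hc

theorem HasWeakDeriv.ae_eq {f g h : ℝ → ℝ} (hg : HasWeakDeriv f g) (hh : HasWeakDeriv f h) :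
    g =ᵐ[volume] h := by
  have key := ae_eq_zero_of_integral_contDiff_smul_eq_zero (μ := volume) (hg.2.1.sub hh.2.1) ?_
  · filter_upwards [key] with y hy
    simpa [sub_eq_zero] using hy
  · intro φ h1 h2
    have e1 := hg.2.2 φ h1 h2
    have e2 := hh.2.2 φ h1 h2
    have i1 : Integrable (fun y => φ y • g y) :=
      hg.2.1.integrable_smul_left_of_hasCompactSupport h1.continuous h2
    have i2 : Integrable (fun y => φ y • h y) :=
      hh.2.1.integrable_smul_left_of_hasCompactSupport h1.continuous h2
    have : ∀ y, φ y • (g - h) y = φ y • g y - φ y • h y := by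
      intro y; simp [mul_sub]
    simp only [this]
    rw [integral_sub i1 i2]
    simp only [smul_eq_mul, mul_comm (φ _)]
    linarith

theorem HasWeakDeriv.weakDeriv {f g : ℝ → ℝ} (hg : HasWeakDeriv f g) :
    HasWeakDeriv f (weakDeriv f) := by
  have h : ∃ g, HasWeakDeriv f g := ⟨g, hg⟩
  unfold DiscODE.weakDeriv
  rw [dif_pos h]
  exact h.choose_spec

theorem weakDeriv_ae_eq_of_lipschitz {f : ℝ → ℝ} {C : ℝ≥0} (hf : LipschitzWith C f) :
    weakDeriv f =ᵐ[volume] deriv f :=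
  (hasWeakDeriv_of_lipschitz hf).weakDeriv.ae_eq (hasWeakDeriv_of_lipschitz hf)

/-- Mollify: moving the derivative onto the kernel shows that the regularised function has
derivative ρₙ * g, bounded by `C` because ρₙ has mass one. Continuity of `f` gives pointwise
convergence, and the Lipschitz bound passes to the limit. -/
theorem HasWeakDeriv.lipschitzWith {f g : ℝ → ℝ} {C : ℝ≥0} (h : HasWeakDeriv f g)
    (hf : Continuous f) (hC : ∀ᵐ y, |g y| ≤ C) : LipschitzWith C f := by
  let b : ℕ → ContDiffBump (0 : ℝ) := fun n =>
    ⟨1 / ((n : ℝ) + 1), 2 * (1 / ((n : ℝ) + 1)), by positivity, by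
      have : 0 < 1 / ((n : ℝ) + 1) := by positivity
      linarith⟩
  have hb : Tendsto (fun n => (b n).rOut) atTop (𝓝 0) := by
    have := (tendsto_one_div_add_atTop_nhds_zero_nat (𝕜 := ℝ)).const_mul 2
    simpa [b] using this
  have hlim := ContDiffBump.convolution_tendsto_right_of_continuous (μ := volume) hb hf
  have hlip : ∀ n, LipschitzWith C
      (convolution ((b n).normed volume) f (ContinuousLinearMap.lsmul ℝ ℝ) volume) := by
    intro n
    have hρ : ContDiff ℝ ∞ ((b n).normed volume) := (b n).contDiff_normed
    have hρc : HasCompactSupport ((b n).normed volume) := (b n).hasCompactSupport_normed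
    have hd := hρc.hasDerivAt_convolution_left (μ := volume) (ContinuousLinearMap.lsmul ℝ ℝ)
      (hρ.of_le (by simp)) hf.locallyIntegrable
    refine lipschitzWith_of_nnnorm_deriv_le (fun x => (hd x).differentiableAt) fun x => ?_
    rw [(hd x).deriv, ← NNReal.coe_le_coe, coe_nnnorm]
    have e : convolution (deriv ((b n).normed volume)) f (ContinuousLinearMap.lsmul ℝ ℝ) volume x
        = ∫ u, g u * (b n).normed volume (x - u) := by
      rw [convolution_eq_swap]
      have hφ : ContDiff ℝ ∞ (fun u => (b n).normed volume (x - u)) :=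
        hρ.comp (contDiff_const.sub contDiff_id)
      have hφc : HasCompactSupport (fun u => (b n).normed volume (x - u)) :=
        hρc.comp_homeomorph (Homeomorph.subLeft x)
      have := h.2.2 _ hφ hφc
      have hder : ∀ u, deriv (fun u => (b n).normed volume (x - u)) u
          = -deriv ((b n).normed volume) (x - u) := fun u => deriv_comp_const_sub _ _ _
      simp only [hder, mul_neg, integral_neg, neg_inj] at this
      rw [← this]
      congr 1
      ext u
      simp [mul_comm]
    rw [e]
    have hi : Integrable (fun u => (b n).normed volume (x - u)) :=
      (b n).integrable_normed.comp_sub_left x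
    calc ‖∫ u, g u * (b n).normed volume (x - u)‖
        ≤ ∫ u, C * (b n).normed volume (x - u) := by
          refine norm_integral_le_of_norm_le (hi.const_mul _) ?_
          filter_upwards [hC] with u hu
          rw [norm_mul, Real.norm_eq_abs, Real.norm_eq_abs,
            abs_of_nonneg ((b n).nonneg_normed _)]
          exact mul_le_mul_of_nonneg_right hu ((b n).nonneg_normed _)
      _ = C := by
          rw [integral_const_mul, integral_sub_left_eq_self (fun u => (b n).normed volume u),
            (b n).integral_normed, mul_one]
  refine LipschitzWith.of_dist_le_mul fun x y => ?_
  exact le_of_tendsto ((hlim x).dist (hlim y)) (Eventually.of_forall fun n => (hlip n).dist_le_mul x y)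

/-! ### Lebesgue measure under Lipschitz maps. -/

theorem volume_image_le_of_lipschitz {f : ℝ → ℝ} {C : ℝ≥0} (hf : LipschitzWith C f) (s : Set ℝ) :
    volume (f '' s) ≤ C * volume s := by
  have := hf.hausdorffMeasure_image_le zero_le_one s
  simpa [hausdorffMeasure_real] using this

/-- The image measure under a bijection whose inverse is Lipschitz. -/
theorem map_volume_le {a A : ℝ → ℝ} {C : ℝ≥0} (ha : Measurable a) (hA : LipschitzWith C A)
    (h : Function.LeftInverse A a) : volume.map a ≤ C • volume := by
  refine Measure.le_iff.2 fun s hs => ?_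
  rw [Measure.map_apply ha hs]
  refine (measure_mono fun x hx => ?_).trans (volume_image_le_of_lipschitz hA s)
  exact ⟨a x, hx, h x⟩

/-- The exceptional set of the composition lies in the Lipschitz image under `A` of a null set. This
is how a.e. differentiability is transported along the changes of variable. -/
theorem ae_comp {a A : ℝ → ℝ} {C : ℝ≥0} (hA : LipschitzWith C A)
    (h : Function.LeftInverse A a) {p : ℝ → Prop} (hp : ∀ᵐ y, p y) : ∀ᵐ x, p (a x) := by
  rw [ae_iff] at hp ⊢
  refine measure_mono_null (t := A '' {y | ¬ p y}) (fun x hx => ⟨a x, hx, h x⟩) ?_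
  have := volume_image_le_of_lipschitz hA {y | ¬ p y}
  rw [hp, mul_zero] at this
  exact le_antisymm this zero_le

/-! ### Grönwall's inequality and Carathéodory equations. -/

/-- The hypothesis says exactly that exp(−Mr)(c + M∫₀ʳ u) has nonpositive derivative on the
interval, so it stays below its initial value `c`. -/
theorem le_mul_exp_of_le_add_integral {u : ℝ → ℝ} {c M T : ℝ} (hu : Continuous u) (hM : 0 ≤ M)
    (h : ∀ t ∈ Icc 0 T, u t ≤ c + M * ∫ s in (0 : ℝ)..t, u s) :
    ∀ t ∈ Icc 0 T, u t ≤ c * Real.exp (M * t) := by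
  intro t ht
  have hd : ∀ r, HasDerivAt (fun r => Real.exp (-(M * r)) * (c + M * ∫ s in (0 : ℝ)..r, u s))
      (Real.exp (-(M * r)) * (-(M * 1)) * (c + M * ∫ s in (0 : ℝ)..r, u s)
        + Real.exp (-(M * r)) * (M * u r)) r := by
    intro r
    have h1 := (((hasDerivAt_id r).const_mul M).neg).exp
    have h2 := ((hu.integral_hasStrictDerivAt 0 r).hasDerivAt.const_mul M).const_add c
    exact h1.mul h2
  have hanti : AntitoneOn
      (fun r => Real.exp (-(M * r)) * (c + M * ∫ s in (0 : ℝ)..r, u s)) (Icc 0 T) := by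
    refine antitoneOn_of_deriv_nonpos (convex_Icc 0 T)
      (fun r _ => (hd r).continuousAt.continuousWithinAt)
      (fun r _ => (hd r).differentiableAt.differentiableWithinAt) fun r hr => ?_
    rw [(hd r).deriv]
    have := h r (interior_subset hr)
    have e : 0 < Real.exp (-(M * r)) := Real.exp_pos _
    have : M * Real.exp (-(M * r)) * u r
        ≤ M * Real.exp (-(M * r)) * (c + M * ∫ s in (0 : ℝ)..r, u s) :=
      mul_le_mul_of_nonneg_left this (by positivity)
    linarith
  have h0 := hanti ⟨le_rfl, ht.1.trans ht.2⟩ ht ht.1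
  simp only [mul_zero, neg_zero, Real.exp_zero, intervalIntegral.integral_same, add_zero,
    one_mul] at h0
  calc u t ≤ c + M * ∫ s in (0 : ℝ)..t, u s := h t ht
    _ = Real.exp (M * t) * (Real.exp (-(M * t)) * (c + M * ∫ s in (0 : ℝ)..t, u s)) := by
      rw [← mul_assoc, ← Real.exp_add, add_neg_cancel, Real.exp_zero, one_mul]
    _ ≤ Real.exp (M * t) * c := mul_le_mul_of_nonneg_left h0 (Real.exp_pos _).le
    _ = c * Real.exp (M * t) := mul_comm _ _

/-- A bounded right-hand side that is measurable in time and Lipschitz in space. -/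
structure IsCaratheodory (f : ℝ → ℝ → ℝ) (M : ℝ≥0) (L : ℝ) : Prop where
  measurable : ∀ z, Measurable fun s => f s z
  lipschitz : ∀ s, LipschitzWith M (f s)
  bound : ∀ s z, |f s z| ≤ L

namespace IsCaratheodory

variable {f : ℝ → ℝ → ℝ} {M : ℝ≥0} {L : ℝ}

theorem measurable_comp (hf : IsCaratheodory f M L) {z : ℝ → ℝ} (hz : Measurable z) :
    Measurable fun s => f s (z s) := by
  have := measurable_uncurry_of_continuous_of_measurable (u := fun z s => f s z)
    (fun s => (hf.lipschitz s).continuous) hf.measurable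
  exact this.comp (hz.prodMk measurable_id)

theorem intervalIntegrable (hf : IsCaratheodory f M L) {z : ℝ → ℝ} (hz : Measurable z) (a b : ℝ) :
    IntervalIntegrable (fun s => f s (z s)) volume a b := by
  refine (intervalIntegrable_const (c := L)).mono_fun
    (hf.measurable_comp hz).aestronglyMeasurable (Eventually.of_forall fun s => ?_)
  simpa using (hf.bound s (z s)).trans (le_abs_self L)

theorem nonneg (hf : IsCaratheodory f M L) : 0 ≤ L := (abs_nonneg _).trans (hf.bound 0 0)

theorem abs_integral_le (hf : IsCaratheodory f M L) (z : ℝ → ℝ) (a b : ℝ) :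
    |∫ s in a..b, f s (z s)| ≤ L * |b - a| := by
  rw [← Real.norm_eq_abs]
  exact intervalIntegral.norm_integral_le_of_norm_le_const fun s _ => hf.bound s (z s)

theorem continuous_integral (hf : IsCaratheodory f M L) {z : ℝ → ℝ} (hz : Measurable z) :
    Continuous fun t => ∫ s in (0 : ℝ)..t, f s (z s) :=
  intervalIntegral.continuous_primitive (fun a b => hf.intervalIntegrable hz a b) 0

theorem abs_sub_le (hf : IsCaratheodory f M L) (s z w : ℝ) : |f s z - f s w| ≤ M * |z - w| := by
  simpa [Real.dist_eq] using (hf.lipschitz s).dist_le_mul z w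

theorem abs_integral_sub_le (hf : IsCaratheodory f M L) {z w : ℝ → ℝ} (hz : Continuous z)
    (hw : Continuous w) {a b : ℝ} (hab : a ≤ b) :
    |(∫ s in a..b, f s (z s)) - ∫ s in a..b, f s (w s)| ≤ M * ∫ s in a..b, |z s - w s| := by
  rw [← intervalIntegral.integral_sub (hf.intervalIntegrable hz.measurable a b)
    (hf.intervalIntegrable hw.measurable a b), ← intervalIntegral.integral_const_mul]
  rw [← Real.norm_eq_abs]
  refine intervalIntegral.norm_integral_le_of_norm_le hab
    (Eventually.of_forall fun s _ => hf.abs_sub_le s _ _) ?_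
  exact (continuous_const.mul (hz.sub hw).abs).intervalIntegrable a b

theorem integral_exp_abs_le {K : ℝ} (hK : 0 < K) (t : ℝ) :
    |∫ s in (0 : ℝ)..t, Real.exp (K * |s|)| ≤ Real.exp (K * |t|) / K := by
  have pos : ∀ t : ℝ, 0 ≤ t →
      |∫ s in (0 : ℝ)..t, Real.exp (K * |s|)| ≤ Real.exp (K * |t|) / K := by
    intro t ht
    have : ∫ s in (0 : ℝ)..t, Real.exp (K * |s|) = ∫ s in (0 : ℝ)..t, Real.exp (K * s) := by
      refine intervalIntegral.integral_congr fun s hs => ?_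
      rw [uIcc_of_le ht] at hs
      simp only [abs_of_nonneg hs.1]
    rw [this, intervalIntegral.integral_comp_mul_left (fun x => Real.exp x) hK.ne', integral_exp,
      abs_of_nonneg ht]
    have h1 : 1 ≤ Real.exp (K * t) := Real.one_le_exp (by positivity)
    simp only [mul_zero, Real.exp_zero, smul_eq_mul]
    rw [abs_of_nonneg (mul_nonneg (by positivity) (by linarith)), inv_mul_eq_div]
    gcongr
    linarith
  rcases le_total 0 t with ht | ht
  · exact pos t ht
  · have := pos (-t) (by linarith)
    rw [abs_neg] at this
    refine le_trans (le_of_eq ?_) this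
    have e := intervalIntegral.integral_comp_neg (a := 0) (b := t)
      (fun s => Real.exp (K * |s|))
    simp only [abs_neg, neg_zero] at e
    rw [e, intervalIntegral.integral_symm, abs_neg]

/-- Picard iteration for u(t) = exp(−K|t|) z(t) on bounded continuous functions on the whole line:
the exponential weight makes the map a contraction with no restriction on the length of time. -/
theorem exists_solution (hf : IsCaratheodory f M L) (z₀ : ℝ) :
    ∃ z : ℝ → ℝ, Continuous z ∧ ∀ t, z t = z₀ + ∫ s in (0 : ℝ)..t, f s (z s) := by
  -- Chosen so that M/K ≤ 1/2, the contraction constant; the summand 1 keeps K positive when M = 0.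
  set K : ℝ := 2 * M + 1 with hKdef
  have hM : (0 : ℝ) ≤ M := M.2
  have hK : 0 < K := by positivity
  have hL := hf.nonneg
  have hcu : ∀ u : ℝ →ᵇ ℝ, Continuous fun s => Real.exp (K * |s|) * u s := fun u =>
    (by fun_prop : Continuous fun s : ℝ => Real.exp (K * |s|)).mul u.continuous
  let Q : (ℝ →ᵇ ℝ) → (ℝ →ᵇ ℝ) := fun u =>
    BoundedContinuousFunction.ofNormedAddCommGroup
      (fun t => Real.exp (-(K * |t|)) *
        (z₀ + ∫ s in (0 : ℝ)..t, f s (Real.exp (K * |s|) * u s)))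
      ((by fun_prop : Continuous fun s : ℝ => Real.exp (-(K * |s|))).mul
        (continuous_const.add (hf.continuous_integral (hcu u).measurable)))
      (|z₀| + L / K)
      (by
        intro t
        rw [norm_mul, Real.norm_eq_abs, Real.norm_eq_abs, Real.abs_exp]
        have h1 : |z₀ + ∫ s in (0 : ℝ)..t, f s (Real.exp (K * |s|) * u s)|
            ≤ |z₀| + L * |t| := by
          refine (abs_add_le _ _).trans ?_
          have := hf.abs_integral_le (fun s => Real.exp (K * |s|) * u s) 0 t
          rw [sub_zero] at this
          linarith
        have h2 : K * |t| ≤ Real.exp (K * |t|) := by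
          linarith [Real.add_one_le_exp (K * |t|)]
        have h3 : 1 ≤ Real.exp (K * |t|) := Real.one_le_exp (by positivity)
        rw [Real.exp_neg, inv_mul_le_iff₀ (Real.exp_pos _)]
        refine h1.trans ?_
        have h4 : L * |t| ≤ Real.exp (K * |t|) * (L / K) := by
          rw [mul_div_assoc', le_div_iff₀ hK]
          nlinarith
        nlinarith [abs_nonneg z₀])
  have hQ : ∀ u t, Q u t = Real.exp (-(K * |t|)) *
      (z₀ + ∫ s in (0 : ℝ)..t, f s (Real.exp (K * |s|) * u s)) := fun _ _ => rfl
  have hcontr : ContractingWith (1 / 2 : ℝ≥0) Q := by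
    refine ⟨by norm_num, LipschitzWith.of_dist_le_mul fun u w => ?_⟩
    rw [BoundedContinuousFunction.dist_le (by positivity)]
    intro t
    rw [Real.dist_eq, hQ, hQ, ← mul_sub, add_sub_add_left_eq_sub, abs_mul, Real.abs_exp,
      ← intervalIntegral.integral_sub (hf.intervalIntegrable (hcu u).measurable 0 t)
        (hf.intervalIntegrable (hcu w).measurable 0 t)]
    have h1 : |∫ s in (0 : ℝ)..t, (f s (Real.exp (K * |s|) * u s)
        - f s (Real.exp (K * |s|) * w s))|
        ≤ |∫ s in (0 : ℝ)..t, M * dist u w * Real.exp (K * |s|)| := by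
      rw [← Real.norm_eq_abs]
      refine intervalIntegral.norm_integral_le_abs_of_norm_le (Eventually.of_forall fun s => ?_)
        ((by fun_prop : Continuous fun s : ℝ => M * dist u w * Real.exp (K * |s|)).intervalIntegrable
          0 t)
      refine (hf.abs_sub_le s _ _).trans ?_
      rw [← mul_sub, abs_mul, Real.abs_exp, mul_assoc, mul_comm (dist u w)]
      have := u.dist_coe_le_dist (g := w) s
      rw [Real.dist_eq] at this
      gcongr
    rw [intervalIntegral.integral_const_mul, abs_mul,
      abs_of_nonneg (by positivity : 0 ≤ M * dist u w)] at h1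
    have h2 := integral_exp_abs_le hK t
    rw [Real.exp_neg, inv_mul_le_iff₀ (Real.exp_pos _)]
    refine h1.trans ((mul_le_mul_of_nonneg_left h2 (by positivity)).trans ?_)
    have h3 : (M : ℝ) / K ≤ 1 / 2 := by
      rw [div_le_iff₀ hK]; rw [hKdef]; linarith
    have : M * dist u w * (Real.exp (K * |t|) / K)
        = Real.exp (K * |t|) * dist u w * (M / K) := by ring
    rw [this]
    calc _ ≤ Real.exp (K * |t|) * dist u w * (1 / 2) := by gcongr
      _ = _ := by push_cast; ring
  have hfix := hcontr.fixedPoint_isFixedPt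
  set u := ContractingWith.fixedPoint Q hcontr
  refine ⟨fun t => Real.exp (K * |t|) * u t, hcu u, fun t => ?_⟩
  have : u t = Q u t := by rw [hfix]
  rw [hQ] at this
  calc Real.exp (K * |t|) * u t = Real.exp (K * |t|) * (Real.exp (-(K * |t|)) *
      (z₀ + ∫ s in (0 : ℝ)..t, f s (Real.exp (K * |s|) * u s))) := by rw [← this]
    _ = _ := by rw [← mul_assoc, ← Real.exp_add, add_neg_cancel, Real.exp_zero, one_mul]

/-- Forward stability of the solutions with respect to the initial value. -/
theorem abs_sub_le_exp (hf : IsCaratheodory f M L) {z w : ℝ → ℝ} {z₀ w₀ T : ℝ}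
    (hz : Continuous z) (hw : Continuous w)
    (hz' : ∀ t ∈ Icc 0 T, z t = z₀ + ∫ s in (0 : ℝ)..t, f s (z s))
    (hw' : ∀ t ∈ Icc 0 T, w t = w₀ + ∫ s in (0 : ℝ)..t, f s (w s)) :
    ∀ t ∈ Icc 0 T, |z t - w t| ≤ |z₀ - w₀| * Real.exp (M * t) := by
  refine le_mul_exp_of_le_add_integral (hz.sub hw).abs M.2 fun t ht => ?_
  rw [hz' t ht, hw' t ht, add_sub_add_comm]
  exact (abs_add_le _ _).trans (add_le_add_right (hf.abs_integral_sub_le hz hw ht.1) _)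

/-- Backward stability of the solutions. -/
theorem abs_sub_le_exp_backward (hf : IsCaratheodory f M L) {z w : ℝ → ℝ} {z₀ w₀ : ℝ}
    (hz : Continuous z) (hw : Continuous w)
    (hz' : ∀ t, z t = z₀ + ∫ s in (0 : ℝ)..t, f s (z s))
    (hw' : ∀ t, w t = w₀ + ∫ s in (0 : ℝ)..t, f s (w s)) {t : ℝ} (ht : 0 ≤ t) :
    |z₀ - w₀| ≤ |z t - w t| * Real.exp (M * t) := by
  -- Grönwall is applied to the difference read backwards from time `t`.
  have key := le_mul_exp_of_le_add_integral (u := fun r => |z (t - r) - w (t - r)|)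
    (c := |z t - w t|) (M := M) (T := t) (by fun_prop) M.2 ?_ t ⟨ht, le_rfl⟩
  · have e1 : z 0 = z₀ := by simpa using hz' 0
    have e2 : w 0 = w₀ := by simpa using hw' 0
    simpa [e1, e2] using key
  · intro r hr
    have hi := hf.abs_integral_sub_le hz hw (show t - r ≤ t by linarith [hr.1])
    have ez : z (t - r) = z t - ∫ s in (t - r)..t, f s (z s) := by
      rw [hz' (t - r), hz' t, ← intervalIntegral.integral_add_adjacent_intervals
        (hf.intervalIntegrable hz.measurable 0 (t - r))
        (hf.intervalIntegrable hz.measurable (t - r) t)]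
      ring
    have ew : w (t - r) = w t - ∫ s in (t - r)..t, f s (w s) := by
      rw [hw' (t - r), hw' t, ← intervalIntegral.integral_add_adjacent_intervals
        (hf.intervalIntegrable hw.measurable 0 (t - r))
        (hf.intervalIntegrable hw.measurable (t - r) t)]
      ring
    have hsub : ∫ s in (0 : ℝ)..r, |z (t - s) - w (t - s)| = ∫ s in (t - r)..t, |z s - w s| := by
      simpa using intervalIntegral.integral_comp_sub_left (a := 0) (b := r)
        (fun s => |z s - w s|) t
    rw [hsub, ez, ew, sub_sub_sub_comm]
    exact (abs_sub _ _).trans (add_le_add_right hi _)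

end IsCaratheodory

/-! ### The flow map of a Carathéodory equation. -/

namespace IsCaratheodory

variable {f : ℝ → ℝ → ℝ} {M : ℝ≥0} {L : ℝ} {Z : ℝ → ℝ → ℝ} {T : ℝ}

theorem abs_flow_sub_le (hf : IsCaratheodory f M L) (hc : ∀ z, Continuous fun t => Z t z)
    (hZ : ∀ t z, Z t z = z + ∫ s in (0 : ℝ)..t, f s (Z s z)) {t : ℝ} (ht : t ∈ Icc 0 T)
    (z w : ℝ) : |Z t z - Z t w| ≤ Real.exp (M * T) * |z - w| := by
  have := hf.abs_sub_le_exp (T := T) (hc z) (hc w) (fun t _ => hZ t z) (fun t _ => hZ t w) t ht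
  rw [mul_comm]
  refine this.trans ?_
  have h2 := ht.2
  gcongr

theorem abs_sub_le_flow (hf : IsCaratheodory f M L) (hc : ∀ z, Continuous fun t => Z t z)
    (hZ : ∀ t z, Z t z = z + ∫ s in (0 : ℝ)..t, f s (Z s z)) {t : ℝ} (ht : t ∈ Icc 0 T)
    (z w : ℝ) : |z - w| ≤ Real.exp (M * T) * |Z t z - Z t w| := by
  have := hf.abs_sub_le_exp_backward (hc z) (hc w) (fun t => hZ t z) (fun t => hZ t w) ht.1
  rw [mul_comm]
  refine this.trans ?_
  have h2 := ht.2
  gcongr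

theorem abs_flow_time_sub_le (hf : IsCaratheodory f M L) (hc : ∀ z, Continuous fun t => Z t z)
    (hZ : ∀ t z, Z t z = z + ∫ s in (0 : ℝ)..t, f s (Z s z)) (t t' z : ℝ) :
    |Z t z - Z t' z| ≤ L * |t - t'| := by
  have hi := fun a b => hf.intervalIntegrable (hc z).measurable a b
  have e : Z t z - Z t' z = ∫ s in t'..t, f s (Z s z) := by
    rw [hZ t, hZ t', add_sub_add_left_eq_sub,
      intervalIntegral.integral_interval_sub_left (hi _ _) (hi _ _)]
  rw [e]
  exact hf.abs_integral_le _ _ _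

/-- The increment over [t', t] is an integral of `f` along trajectories, whose separation is at most
exp(MT)|z − w|. Read as a Lipschitz bound for Z_t − Z_t', this controls the difference of spatial
derivatives and produces the term with |X| in the final estimate. -/
theorem abs_flow_double_sub_le (hf : IsCaratheodory f M L) (hc : ∀ z, Continuous fun t => Z t z)
    (hZ : ∀ t z, Z t z = z + ∫ s in (0 : ℝ)..t, f s (Z s z)) {t t' : ℝ} (ht : t ∈ Icc 0 T)
    (ht' : t' ∈ Icc 0 T) (z w : ℝ) :
    |(Z t z - Z t' z) - (Z t w - Z t' w)|
      ≤ M * Real.exp (M * T) * |t - t'| * |z - w| := by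
  have hi := fun z a b => hf.intervalIntegrable (hc z).measurable a b
  have e : ∀ z, Z t z - Z t' z = ∫ s in t'..t, f s (Z s z) := by
    intro z
    rw [hZ t, hZ t', add_sub_add_left_eq_sub,
      intervalIntegral.integral_interval_sub_left (hi _ _ _) (hi _ _ _)]
  rw [e, e, ← intervalIntegral.integral_sub (hi _ _ _) (hi _ _ _)]
  have hle : ∀ s ∈ uIoc t' t, ‖f s (Z s z) - f s (Z s w)‖
      ≤ M * (Real.exp (M * T) * |z - w|) := by
    intro s hs
    have hs' : s ∈ Icc 0 T := by
      have := uIoc_subset_uIcc.trans (uIcc_subset_Icc ht' ht) hs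
      exact this
    exact (hf.abs_sub_le s _ _).trans
      (mul_le_mul_of_nonneg_left (hf.abs_flow_sub_le hc hZ hs' z w) M.2)
  have := intervalIntegral.norm_integral_le_of_norm_le_const hle
  rw [Real.norm_eq_abs] at this
  refine this.trans (le_of_eq (by ring))

/-- If the order were lost by time `t`, the two trajectories would meet earlier by the intermediate
value theorem, and backward stability would force equal initial values. -/
theorem strictMono_flow (hf : IsCaratheodory f M L) (hc : ∀ z, Continuous fun t => Z t z)
    (hZ : ∀ t z, Z t z = z + ∫ s in (0 : ℝ)..t, f s (Z s z)) {t : ℝ} (ht : t ∈ Icc 0 T) :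
    StrictMono (Z t) := by
  intro z w hzw
  by_contra! hle
  have h0 : ∀ z, Z 0 z = z := fun z => by simpa using hZ 0 z
  obtain ⟨s, hs, hs'⟩ : (0 : ℝ) ∈ (fun s => Z s w - Z s z) '' Icc 0 t := by
    refine intermediate_value_Icc' ht.1 ((hc w).sub (hc z)).continuousOn ⟨?_, ?_⟩
    · simpa using hle
    · simpa [h0] using hzw.le
  have := hf.abs_sub_le_flow (T := T) hc hZ ⟨hs.1, hs.2.trans ht.2⟩ w z
  simp only at hs'
  rw [hs', abs_zero, mul_zero] at this
  have := abs_pos.2 (sub_pos.2 hzw).ne'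
  linarith

/-- `Z t` is continuous and stays within L|t| of the identity, hence tends to ±∞ at ±∞. -/
theorem surjective_flow (hf : IsCaratheodory f M L) (hc : ∀ z, Continuous fun t => Z t z)
    (hZ : ∀ t z, Z t z = z + ∫ s in (0 : ℝ)..t, f s (Z s z)) {t : ℝ} (ht : t ∈ Icc 0 T) :
    Function.Surjective (Z t) := by
  have hcont : Continuous (Z t) := by
    refine (LipschitzWith.of_dist_le_mul (K := ⟨Real.exp (M * T), (Real.exp_pos _).le⟩)
      fun z w => ?_).continuous
    rw [Real.dist_eq, Real.dist_eq]
    exact hf.abs_flow_sub_le hc hZ ht z w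
  have hb : ∀ z, |Z t z - z| ≤ L * |t| := by
    intro z
    have h0 : Z 0 z = z := by simpa using hZ 0 z
    have := hf.abs_flow_time_sub_le hc hZ t 0 z
    rwa [h0, sub_zero] at this
  refine hcont.surjective ?_ ?_
  · refine tendsto_atTop_mono (f := fun z => z - L * |t|) (fun z => ?_)
      (tendsto_atTop_add_const_right _ _ tendsto_id)
    linarith [(abs_le.1 (hb z)).1]
  · refine tendsto_atBot_mono (f := fun z => z + L * |t|) (fun z => ?_)
      (tendsto_atBot_add_const_right _ _ tendsto_id)
    linarith [(abs_le.1 (hb z)).2]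

theorem exists_orderIso_flow (hf : IsCaratheodory f M L) (hc : ∀ z, Continuous fun t => Z t z)
    (hZ : ∀ t z, Z t z = z + ∫ s in (0 : ℝ)..t, f s (Z s z)) {t : ℝ} (ht : t ∈ Icc 0 T) :
    ∃ ζ : ℝ ≃o ℝ, (∀ z, ζ z = Z t z) ∧ LipschitzWith (Real.exp (M * T)).toNNReal ζ ∧
      LipschitzWith (Real.exp (M * T)).toNNReal ζ.symm := by
  refine ⟨(hf.strictMono_flow hc hZ ht).orderIsoOfSurjective _ (hf.surjective_flow hc hZ ht),
    fun _ => rfl, LipschitzWith.of_dist_le_mul fun z w => ?_,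
    LipschitzWith.of_dist_le_mul fun z w => ?_⟩
  · rw [Real.dist_eq, Real.dist_eq, Real.coe_toNNReal _ (Real.exp_pos _).le]
    exact hf.abs_flow_sub_le hc hZ ht z w
  · set ζ := (hf.strictMono_flow hc hZ ht).orderIsoOfSurjective _ (hf.surjective_flow hc hZ ht)
    rw [Real.dist_eq, Real.dist_eq, Real.coe_toNNReal _ (Real.exp_pos _).le]
    have e : ∀ z, Z t (ζ.symm z) = z := fun z => ζ.apply_symm_apply z
    have := hf.abs_sub_le_flow hc hZ ht (ζ.symm z) (ζ.symm w)
    rwa [e, e] at this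

end IsCaratheodory

/-! ### Straightening by the primitive of `1 / v`. -/

section Primitive

variable {v : ℝ → ℝ} {m V : ℝ}

theorem intervalIntegrable_one_div (hm : 0 < m) (hv : Measurable v) (h1 : ∀ y, m ≤ v y) (a b : ℝ) :
    IntervalIntegrable (fun y => 1 / v y) volume a b := by
  refine (intervalIntegrable_const (c := 1 / m)).mono_fun
    (measurable_const.div hv).aestronglyMeasurable (Eventually.of_forall fun y => ?_)
  have := hm.trans_le (h1 y)
  simp only [Real.norm_eq_abs]
  rw [abs_of_pos (by positivity), abs_of_pos (by positivity)]
  exact one_div_le_one_div_of_le hm (h1 y)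

/-- The primitive of `1 / v` is a bi-Lipschitz increasing bijection. -/
theorem exists_orderIso_primitive (hm : 0 < m) (hv : Measurable v) (h1 : ∀ y, m ≤ v y)
    (h2 : ∀ y, v y ≤ V) :
    ∃ G : ℝ ≃o ℝ, (∀ a b, ∫ y in a..b, 1 / v y = G b - G a) ∧
      LipschitzWith (1 / m).toNNReal G ∧ LipschitzWith V.toNNReal G.symm ∧
      ∀ᵐ x, HasDerivAt G (1 / v x) x := by
  have hV : 0 < V := hm.trans_le ((h1 0).trans (h2 0))
  have hi := intervalIntegrable_one_div hm hv h1
  set g : ℝ → ℝ := fun x => ∫ y in (0 : ℝ)..x, 1 / v y with hg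
  have hsub : ∀ a b, ∫ y in a..b, 1 / v y = g b - g a := fun a b =>
    (intervalIntegral.integral_interval_sub_left (hi _ _) (hi _ _)).symm
  -- From 1/v ≥ 1/V: the primitive expands at least at rate 1/V, which yields strict monotonicity,
  -- surjectivity and the Lipschitz bound of the inverse.
  have hlow : ∀ a b, a ≤ b → (b - a) ≤ V * (g b - g a) := by
    intro a b hab
    rw [← hsub]
    have : ∫ y in a..b, (1 / V : ℝ) ≤ ∫ y in a..b, 1 / v y := by
      refine intervalIntegral.integral_mono_on hab intervalIntegrable_const (hi a b) fun y _ => ?_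
      exact one_div_le_one_div_of_le (hm.trans_le (h1 y)) (h2 y)
    rw [intervalIntegral.integral_const, smul_eq_mul, mul_one_div, div_le_iff₀ hV] at this
    linarith
  have hmono : StrictMono g := by
    intro a b hab
    have := hlow a b hab.le
    by_contra! h
    nlinarith
  have hlip : LipschitzWith (1 / m).toNNReal g := by
    refine LipschitzWith.of_dist_le_mul fun x y => ?_
    rw [Real.coe_toNNReal _ (by positivity), Real.dist_eq, Real.dist_eq, ← hsub,
      ← Real.norm_eq_abs]
    refine intervalIntegral.norm_integral_le_of_norm_le_const fun s _ => ?_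
    have := hm.trans_le (h1 s)
    rw [Real.norm_eq_abs, abs_of_pos (by positivity)]
    exact one_div_le_one_div_of_le hm (h1 s)
  have hg0 : g 0 = 0 := by simp [hg]
  have hsurj : Function.Surjective g := by
    refine hlip.continuous.surjective ?_ ?_
    · refine tendsto_atTop_mono' atTop (f₁ := fun x => x / V) ?_
        (tendsto_id.atTop_div_const hV)
      filter_upwards [eventually_ge_atTop 0] with x hx
      have := hlow 0 x hx
      rw [hg0] at this
      rw [div_le_iff₀ hV]
      linarith
    · refine tendsto_atBot_mono' atBot (f₁ := fun x => x / V) ?_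
        (tendsto_id.atBot_div_const hV)
      filter_upwards [eventually_le_atBot 0] with x hx
      have := hlow x 0 hx
      rw [hg0] at this
      rw [le_div_iff₀ hV]
      linarith
  refine ⟨hmono.orderIsoOfSurjective _ hsurj, hsub, hlip, ?_, ?_⟩
  · set G := hmono.orderIsoOfSurjective _ hsurj
    have e : ∀ z, g (G.symm z) = z := fun z => G.apply_symm_apply z
    refine LipschitzWith.of_dist_le_mul fun z w => ?_
    rw [Real.coe_toNNReal _ hV.le, Real.dist_eq, Real.dist_eq]
    rcases le_total z w with h | h
    · have := hlow _ _ (G.symm.monotone h)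
      rw [e, e] at this
      rw [abs_sub_comm, abs_sub_comm z w, abs_of_nonneg (sub_nonneg.2 (G.symm.monotone h)),
        abs_of_nonneg (sub_nonneg.2 h)]
      exact this
    · have := hlow _ _ (G.symm.monotone h)
      rw [e, e] at this
      rw [abs_of_nonneg (sub_nonneg.2 (G.symm.monotone h)), abs_of_nonneg (sub_nonneg.2 h)]
      exact this
  · have hloc : LocallyIntegrable (fun y => 1 / v y) volume :=
      locallyIntegrable_of_bound (C := 1 / m) (measurable_const.div hv).aestronglyMeasurable
        (Eventually.of_forall fun s => by
          have := hm.trans_le (h1 s)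
          rw [abs_of_pos (by positivity)]
          exact one_div_le_one_div_of_le hm (h1 s))
    filter_upwards [LocallyIntegrable.ae_hasDerivAt_integral hloc] with x hx
    exact hx 0

/-- The derivative of a bi-Lipschitz map conjugated by the primitive of `1 / v`. -/
theorem ae_hasDerivAt_conj (hpos : ∀ y, 0 < v y) {G ζ : ℝ ≃o ℝ} {A B C D : ℝ≥0}
    (hG : LipschitzWith A G) (hG' : LipschitzWith B G.symm) (hd : ∀ᵐ x, HasDerivAt G (1 / v x) x)
    (hζ : LipschitzWith C ζ) (hζ' : LipschitzWith D ζ.symm) :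
    ∀ᵐ x, HasDerivAt (fun x => G.symm (ζ (G x)))
      (v (G.symm (ζ (G x))) * deriv ζ (G x) / v x) x := by
  have h1 : ∀ᵐ x, DifferentiableAt ℝ ζ (G x) :=
    ae_comp hG' G.symm_apply_apply hζ.ae_differentiableAt_real
  -- `G` must also be differentiable at the image point, with nonzero derivative, so that its
  -- inverse can be differentiated there; the full map has a Lipschitz inverse, so this holds for
  -- a.e. `x`.
  have h2 : ∀ᵐ x, HasDerivAt G (1 / v (G.symm (ζ (G x)))) (G.symm (ζ (G x))) :=
    ae_comp (a := fun x => G.symm (ζ (G x))) (A := fun x => G.symm (ζ.symm (G x)))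
      (hG'.comp (hζ'.comp hG)) (fun x => by simp) hd
  filter_upwards [hd, h1, h2] with x hx hx1 hx2
  have h3 : HasDerivAt G.symm (1 / v (G.symm (ζ (G x))))⁻¹ (ζ (G x)) :=
    HasDerivAt.of_local_left_inverse hG'.continuous.continuousAt hx2
      (one_div_pos.2 (hpos _)).ne' (Eventually.of_forall fun y => G.apply_symm_apply y)
  have := (h3.comp (G x) hx1.hasDerivAt).comp x hx
  refine this.congr_deriv ?_
  rw [one_div (v _), inv_inv, mul_one_div]

end Primitive

/-! ### Total variation and composition with bi-Lipschitz maps. -/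

theorem integrable_of_bound_of_isCompact {f : ℝ → ℝ} {C : ℝ} {S : Set ℝ}
    (hf : AEStronglyMeasurable f volume) (hC : ∀ y, |f y| ≤ C) (hS : IsCompact S)
    (h0 : ∀ y, y ∉ S → f y = 0) : Integrable f := by
  have : IntegrableOn f S :=
    Measure.integrableOn_of_bounded (M := C) hS.measure_lt_top.ne hf
      (Eventually.of_forall fun y => by simpa using hC y)
  rwa [integrableOn_iff_integrable_of_support_subset] at this
  intro y hy
  by_contra h
  exact hy (h0 y h)

/-- The forward average of a continuous function is a primitive of its difference quotient. -/
theorem hasDerivAt_forward_average {φ : ℝ → ℝ} (hφ : Continuous φ) (ε y : ℝ) :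
    HasDerivAt (fun y => ε⁻¹ * ∫ u in y..y + ε, φ u) (ε⁻¹ * (φ (y + ε) - φ y)) y := by
  have hi := fun a b => hφ.intervalIntegrable (μ := volume) a b
  have h1 : (fun y => ε⁻¹ * ∫ u in y..y + ε, φ u) =
      fun y => ε⁻¹ * ((∫ u in (0 : ℝ)..y + ε, φ u) - ∫ u in (0 : ℝ)..y, φ u) := by
    ext y
    rw [intervalIntegral.integral_interval_sub_left (hi _ _) (hi _ _)]
  rw [h1]
  have h2 := (hφ.integral_hasStrictDerivAt 0 (y + ε)).hasDerivAt.comp_add_const y ε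
  have h3 := (hφ.integral_hasStrictDerivAt 0 y).hasDerivAt
  exact (h2.sub h3).const_mul _

/-- The difference quotient is the derivative of the average of φ over [y, y + ε]. That average,
divided by `C`, is C¹, bounded by 1 and supported in the ε-thickening of `S`, hence an admissible
test function. -/
theorem integral_mul_forward_difference_le {v φ : ℝ → ℝ} {C ε : ℝ} {S Ω : Set ℝ}
    (hTV : totalVar v Ω ≠ ⊤) (hφ : Continuous φ) (hC : 0 < C) (hφC : ∀ y, |φ y| ≤ C)
    (hS : IsCompact S) (h0 : ∀ y, y ∉ S → φ y = 0) (hε : 0 < ε)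
    (hΩ : Metric.cthickening ε S ⊆ Ω) :
    ∫ y, v y * (ε⁻¹ * (φ (y + ε) - φ y)) ≤ C * (totalVar v Ω).toReal := by
  set χ : ℝ → ℝ := fun y => C⁻¹ * (ε⁻¹ * ∫ u in y..y + ε, φ u) with hχ
  have hd : ∀ y, HasDerivAt χ (C⁻¹ * (ε⁻¹ * (φ (y + ε) - φ y))) y := fun y =>
    (hasDerivAt_forward_average hφ ε y).const_mul _
  have hderiv : deriv χ = fun y => C⁻¹ * (ε⁻¹ * (φ (y + ε) - φ y)) := funext fun y => (hd y).deriv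
  have hsupp : tsupport χ ⊆ Metric.cthickening ε S := by
    refine closure_minimal (fun y hy => ?_) Metric.isClosed_cthickening
    by_contra hn
    apply hy
    have : ∫ u in y..y + ε, φ u = 0 := by
      refine (intervalIntegral.integral_congr (g := fun _ => 0) fun u hu => ?_).trans (by simp)
      refine h0 u fun huS => hn ?_
      rw [uIcc_of_le (by linarith)] at hu
      refine Metric.mem_cthickening_of_dist_le y u ε S huS ?_
      rw [Real.dist_eq, abs_le]
      constructor <;> linarith [hu.1, hu.2]
    simp [hχ, this]
  have hbd : ∀ y, |χ y| ≤ 1 := by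
    intro y
    have : |∫ u in y..y + ε, φ u| ≤ C * ε := by
      have := intervalIntegral.norm_integral_le_of_norm_le_const (a := y) (b := y + ε)
        (f := φ) (fun u _ => hφC u)
      rwa [Real.norm_eq_abs, add_sub_cancel_left, abs_of_pos hε] at this
    rw [hχ]
    simp only [abs_mul, abs_inv, abs_of_pos hC, abs_of_pos hε]
    rw [inv_mul_le_iff₀ hC, inv_mul_le_iff₀ hε]
    linarith
  have htest : ENNReal.ofReal (∫ y, v y * deriv χ y) ≤ totalVar v Ω := by
    refine le_iSup₂_of_le (f := fun (φ : ℝ → ℝ) (_ : ContDiff ℝ 1 φ ∧ HasCompactSupport φ ∧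
      tsupport φ ⊆ Ω ∧ ∀ y, |φ y| ≤ 1) => ENNReal.ofReal (∫ y, v y * deriv φ y)) χ
      ⟨?_, ?_, hsupp.trans hΩ, hbd⟩ le_rfl
    · rw [contDiff_one_iff_deriv, hderiv]
      exact ⟨fun y => (hd y).differentiableAt, by fun_prop⟩
    · exact hS.cthickening.of_isClosed_subset (isClosed_tsupport _) hsupp
  rw [hderiv] at htest
  have hle := (ENNReal.ofReal_le_iff_le_toReal hTV).1 htest
  have e : ∀ y, v y * (C⁻¹ * (ε⁻¹ * (φ (y + ε) - φ y)))
      = C⁻¹ * (v y * (ε⁻¹ * (φ (y + ε) - φ y))) := fun y => by ring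
  simp only [e] at hle
  rwa [integral_const_mul, inv_mul_le_iff₀ hC] at hle

/-- The duality estimate for the total variation, extended to Lipschitz test functions. -/
theorem integral_mul_deriv_le_totalVar {v φ : ℝ → ℝ} {C V : ℝ} {D : ℝ≥0} {S Ω : Set ℝ}
    (hv : Measurable v) (hV : ∀ y, |v y| ≤ V) (hTV : totalVar v Ω ≠ ⊤) (hφ : LipschitzWith D φ)
    (hφC : ∀ y, |φ y| ≤ C) (hS : IsCompact S) (h0 : ∀ y, y ∉ S → φ y = 0) (hΩ : IsOpen Ω)
    (hSΩ : S ⊆ Ω) :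
    ∫ y, v y * deriv φ y ≤ C * (totalVar v Ω).toReal := by
  -- The case C = 0 is separated because test functions are normalised by C⁻¹.
  rcases ((abs_nonneg _).trans (hφC 0)).eq_or_lt with hC | hC
  · have : φ = fun _ => 0 := by
      ext y
      have := hφC y
      rw [← hC] at this
      exact abs_nonpos_iff.1 this
    simp [this, ← hC]
  obtain ⟨δ, hδ, hδΩ⟩ := hS.exists_cthickening_subset_open hΩ hSΩ
  set ε : ℕ → ℝ := fun n => δ * (1 / ((n : ℝ) + 1)) with hε
  have hεpos : ∀ n, 0 < ε n := fun n => by positivity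
  have hεle : ∀ n, ε n ≤ δ := fun n => by
    have : 1 / ((n : ℝ) + 1) ≤ 1 := by
      rw [div_le_one (by positivity)]
      linarith [n.cast_nonneg (α := ℝ)]
    calc ε n ≤ δ * 1 := mul_le_mul_of_nonneg_left this hδ.le
      _ = δ := mul_one δ
  have hε0 : Tendsto ε atTop (𝓝[≠] 0) := by
    refine tendsto_nhdsWithin_iff.2 ⟨?_, Eventually.of_forall fun n => (hεpos n).ne'⟩
    have := (tendsto_one_div_add_atTop_nhds_zero_nat (𝕜 := ℝ)).const_mul δ
    rwa [mul_zero] at this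
  have hVnn : 0 ≤ V := (abs_nonneg _).trans (hV 0)
  -- Dominated convergence: the quotients are bounded by `D`, vanish off a fixed compact set, and
  -- converge wherever φ is differentiable, which is a.e. by Rademacher.
  have hlim : Tendsto (fun n => ∫ y, v y * ((ε n)⁻¹ * (φ (y + ε n) - φ y))) atTop
      (𝓝 (∫ y, v y * deriv φ y)) := by
    refine tendsto_integral_of_dominated_convergence
      ((Metric.cthickening δ S).indicator fun _ => V * D) (fun n => ?_) ?_ (fun n => ?_) ?_
    · have := hφ.continuous
      exact (hv.mul (by fun_prop : Continuous
        fun y => (ε n)⁻¹ * (φ (y + ε n) - φ y)).measurable).aestronglyMeasurable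
    · exact (integrableOn_const (hS.cthickening.measure_lt_top.ne)).integrable_indicator
        Metric.isClosed_cthickening.measurableSet
    · refine Eventually.of_forall fun y => ?_
      by_cases hy : y ∈ Metric.cthickening δ S
      · rw [indicator_of_mem hy, norm_mul, Real.norm_eq_abs, Real.norm_eq_abs, abs_mul, abs_inv,
          abs_of_pos (hεpos n)]
        have h1 := hφ.dist_le_mul (y + ε n) y
        rw [Real.dist_eq, Real.dist_eq, add_sub_cancel_left, abs_of_pos (hεpos n)] at h1
        refine mul_le_mul (hV y) ?_ (by have := hεpos n; positivity) hVnn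
        rw [inv_mul_le_iff₀ (hεpos n)]
        linarith
      · rw [indicator_of_notMem hy]
        have e1 : φ y = 0 := h0 y fun h => hy (Metric.self_subset_cthickening S h)
        have e2 : φ (y + ε n) = 0 := by
          refine h0 _ fun h => hy (Metric.mem_cthickening_of_dist_le _ _ _ _ h ?_)
          rw [Real.dist_eq, sub_add_cancel_left, abs_neg, abs_of_pos (hεpos n)]
          exact hεle n
        simp [e1, e2]
    · filter_upwards [hφ.ae_differentiableAt_real] with y hy
      exact (hy.hasDerivAt.tendsto_slope_zero.comp hε0).const_mul (v y)
  refine le_of_tendsto hlim (Eventually.of_forall fun n => ?_)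
  exact integral_mul_forward_difference_le hTV hφ.continuous hC hφC hS h0 (hεpos n)
    ((Metric.cthickening_mono (hεle n) S).trans hδΩ)

/-- Change of variables on the set where `a` is differentiable; its complement and the image of the
complement are null, and monotonicity removes the absolute value of the derivative. -/
theorem integral_eq_integral_deriv_mul_comp {a : ℝ ≃o ℝ} {A : ℝ≥0} (ha : LipschitzWith A a)
    (g : ℝ → ℝ) : ∫ x, g x = ∫ y, deriv a y * g (a y) := by
  set s := {y | DifferentiableAt ℝ a y}
  have hs : MeasurableSet s := measurableSet_of_differentiableAt ℝ a
  have hs0 : volume sᶜ = 0 := ha.ae_differentiableAt_real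
  have hs1 : volume (a '' s)ᶜ = 0 := by
    rw [← image_compl_eq a.bijective]
    have := volume_image_le_of_lipschitz ha sᶜ
    rw [hs0, mul_zero] at this
    exact le_antisymm this zero_le
  have h := integral_image_eq_integral_abs_deriv_smul hs
    (fun x hx => (hx : DifferentiableAt ℝ a x).hasDerivAt.hasDerivWithinAt) a.injective.injOn g
  rw [Measure.restrict_eq_self_of_ae_mem (s := a '' s) (mem_ae_iff.2 hs1),
    Measure.restrict_eq_self_of_ae_mem (s := s) (mem_ae_iff.2 hs0)] at h
  rw [h]
  simp only [smul_eq_mul, abs_of_nonneg a.monotone.deriv_nonneg]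

/-- The chain rule for the primitive of a bounded function and a bi-Lipschitz map. -/
theorem ae_hasDerivAt_primitive_comp {a : ℝ ≃o ℝ} {A B : ℝ≥0} (ha : LipschitzWith A a)
    (hA : LipschitzWith B a.symm) {ψ : ℝ → ℝ} (hψ : LocallyIntegrable ψ volume) :
    ∀ᵐ y, HasDerivAt (fun y => ∫ u in (0 : ℝ)..a y, ψ u) (ψ (a y) * deriv a y) y := by
  have h1 := ae_comp hA a.symm_apply_apply (LocallyIntegrable.ae_hasDerivAt_integral hψ)
  filter_upwards [h1, ha.ae_differentiableAt_real] with y hy hy'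
  exact (hy 0).comp y hy'.hasDerivAt

/-- Substituting y = a(x) and y = b(x) in the two terms moves the composition from `v`, which is
rough, to ψ. The result is ∫ v φ' for a Lipschitz φ as small as the distance between the inverse
maps. -/
theorem integral_comp_sub_mul_le_totalVar {v ψ : ℝ → ℝ} {V C : ℝ} {a b : ℝ ≃o ℝ} {A A' B B' : ℝ≥0}
    (hv : Measurable v) (hV : ∀ y, |v y| ≤ V) (ha : LipschitzWith A a)
    (ha' : LipschitzWith A' a.symm) (hb : LipschitzWith B b) (hb' : LipschitzWith B' b.symm)
    (hC : ∀ y, |a.symm y - b.symm y| ≤ C) {K Ω : Set ℝ} (hK : IsCompact K) (hΩ : IsOpen Ω)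
    (hKΩ : ∀ x ∈ K, uIcc (a x) (b x) ⊆ Ω) (hTV : totalVar v Ω ≠ ⊤)
    (hψ : Measurable ψ) (hψ1 : ∀ x, |ψ x| ≤ 1) (hψK : ∀ x, x ∉ K → ψ x = 0) :
    ∫ x, (v (a x) - v (b x)) * ψ x ≤ C * (totalVar v Ω).toReal := by
  have hVnn : 0 ≤ V := (abs_nonneg _).trans (hV 0)
  have hψloc : LocallyIntegrable ψ volume :=
    locallyIntegrable_of_bound hψ.aestronglyMeasurable (Eventually.of_forall hψ1)
  have hi : ∀ p q, IntervalIntegrable ψ volume p q := fun p q =>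
    (hψloc.integrableOn_isCompact isCompact_uIcc).intervalIntegrable
  -- the change of variables for each of the two maps
  have key : ∀ (c : ℝ ≃o ℝ) (E E' : ℝ≥0), LipschitzWith E c → LipschitzWith E' c.symm →
      Integrable (fun x => v (c x) * ψ x) ∧
      Integrable (fun y => v y * (ψ (c.symm y) * deriv c.symm y)) ∧
      ∫ x, v (c x) * ψ x = ∫ y, v y * (ψ (c.symm y) * deriv c.symm y) := by
    intro c E E' hc hc'
    refine ⟨?_, ?_, ?_⟩
    · refine integrable_of_bound_of_isCompact (C := V * 1)
        ((hv.comp hc.continuous.measurable).mul hψ).aestronglyMeasurable (fun y => ?_) hK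
        fun y hy => by simp [hψK y hy]
      rw [abs_mul]
      exact mul_le_mul (hV _) (hψ1 _) (abs_nonneg _) hVnn
    · refine integrable_of_bound_of_isCompact (C := V * (1 * E')) (S := c '' K)
        (hv.mul ((hψ.comp hc'.continuous.measurable).mul
          (measurable_deriv _))).aestronglyMeasurable (fun y => ?_) (hK.image hc.continuous)
        fun y hy => ?_
      · rw [abs_mul, abs_mul]
        refine mul_le_mul (hV _) ?_ (by positivity) hVnn
        exact mul_le_mul (hψ1 _) (norm_deriv_le_of_lipschitz hc') (abs_nonneg _) zero_le_one
      · rw [hψK, zero_mul, mul_zero]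
        exact fun h => hy ⟨_, h, c.apply_symm_apply y⟩
    · rw [integral_eq_integral_deriv_mul_comp hc' fun x => v (c x) * ψ x]
      congr 1
      ext y
      rw [c.apply_symm_apply]
      ring
  obtain ⟨ia, ja, ea⟩ := key a A A' ha ha'
  obtain ⟨ib, jb, eb⟩ := key b B B' hb hb'
  set φ : ℝ → ℝ := fun y => (∫ u in (0 : ℝ)..a.symm y, ψ u) - ∫ u in (0 : ℝ)..b.symm y, ψ u
    with hφ
  have hprim : LipschitzWith 1 fun x => ∫ u in (0 : ℝ)..x, ψ u := by
    refine LipschitzWith.of_dist_le_mul fun x y => ?_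
    rw [Real.dist_eq, Real.dist_eq, intervalIntegral.integral_interval_sub_left (hi _ _) (hi _ _)]
    rw [← Real.norm_eq_abs]
    exact intervalIntegral.norm_integral_le_of_norm_le_const fun s _ => hψ1 s
  have hφlip := (hprim.comp ha').sub (hprim.comp hb')
  have hφint : ∀ y, φ y = ∫ u in b.symm y..a.symm y, ψ u := fun y =>
    intervalIntegral.integral_interval_sub_left (hi _ _) (hi _ _)
  have hφC : ∀ y, |φ y| ≤ C := by
    intro y
    rw [hφint, ← Real.norm_eq_abs]
    refine (intervalIntegral.norm_integral_le_of_norm_le_const fun s _ => hψ1 s).trans ?_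
    rw [one_mul]
    exact hC y
  -- The union over x ∈ K of the segments between a(x) and b(x), as a continuous image of a compact
  -- set. If y is outside it, no point of `K` lies between a⁻¹(y) and b⁻¹(y), so φ(y) = 0.
  set S := (fun p : ℝ × ℝ => (1 - p.2) * a p.1 + p.2 * b p.1) '' (K ×ˢ Icc 0 1)
  have hSeq : ∀ y, y ∈ S ↔ ∃ x ∈ K, y ∈ uIcc (a x) (b x) := by
    intro y
    constructor
    · rintro ⟨⟨x, s⟩, ⟨hx, hs⟩, rfl⟩
      refine ⟨x, hx, ?_⟩
      rw [← segment_eq_uIcc]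
      exact ⟨1 - s, s, by linarith [hs.2], hs.1, by ring, rfl⟩
    · rintro ⟨x, hx, hy⟩
      rw [← segment_eq_uIcc] at hy
      obtain ⟨p, q, hp, hq, hpq, rfl⟩ := hy
      refine ⟨(x, q), ⟨hx, hq, by linarith⟩, ?_⟩
      have : p = 1 - q := by linarith
      simp [this]
  have hS : IsCompact S := by
    refine (hK.prod isCompact_Icc).image ?_
    have := ha.continuous
    have := hb.continuous
    fun_prop
  have h0 : ∀ y, y ∉ S → φ y = 0 := by
    intro y hy
    rw [hφint]
    refine (intervalIntegral.integral_congr (g := fun _ => 0) fun u hu => ?_).trans (by simp)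
    refine hψK u fun huK => hy ((hSeq y).2 ⟨u, huK, ?_⟩)
    rw [mem_uIcc] at hu ⊢
    rcases hu with ⟨h1, h2⟩ | ⟨h1, h2⟩
    · exact Or.inl ⟨a.le_symm_apply.1 h2, b.symm_apply_le.1 h1⟩
    · exact Or.inr ⟨b.le_symm_apply.1 h2, a.symm_apply_le.1 h1⟩
  have hSΩ : S ⊆ Ω := fun y hy => by
    obtain ⟨x, hx, hy⟩ := (hSeq y).1 hy
    exact hKΩ x hx hy
  have hmain := integral_mul_deriv_le_totalVar hv hV hTV hφlip hφC hS h0 hΩ hSΩ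
  refine le_trans (le_of_eq ?_) hmain
  calc ∫ x, (v (a x) - v (b x)) * ψ x = ∫ x, (v (a x) * ψ x - v (b x) * ψ x) := by
        simp only [sub_mul]
    _ = ∫ y, (v y * (ψ (a.symm y) * deriv a.symm y) - v y * (ψ (b.symm y) * deriv b.symm y)) := by
        rw [integral_sub ia ib, ea, eb, integral_sub ja jb]
    _ = _ := by
        apply integral_congr_ae
        filter_upwards [ae_hasDerivAt_primitive_comp ha' (a := a.symm) ha hψloc,
          ae_hasDerivAt_primitive_comp hb' (a := b.symm) hb hψloc] with y h1 h2
        rw [← mul_sub]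
        exact congrArg _ (h1.sub h2).deriv.symm

/-- Take ψ to be the sign of the difference. The duality bound needs ψ supported in a compact set,
so `X` is exhausted by increasing closed, hence compact, subsets. -/
theorem lintegral_comp_sub_le_totalVar {v : ℝ → ℝ} {V C : ℝ} {a b : ℝ ≃o ℝ} {A A' B B' : ℝ≥0}
    (hv : Measurable v) (hV : ∀ y, |v y| ≤ V) (ha : LipschitzWith A a)
    (ha' : LipschitzWith A' a.symm) (hb : LipschitzWith B b) (hb' : LipschitzWith B' b.symm)
    (hC : ∀ y, |a.symm y - b.symm y| ≤ C) {X Ω : Set ℝ} (hX : IsOpen X)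
    (hXb : Bornology.IsBounded X) (hΩ : IsOpen Ω)
    (hXΩ : ∀ x ∈ X, uIcc (a x) (b x) ⊆ Ω) (hTV : totalVar v Ω ≠ ⊤) :
    ∫⁻ x in X, ‖v (a x) - v (b x)‖ₑ ≤ ENNReal.ofReal (C * (totalVar v Ω).toReal) := by
  obtain ⟨F, hFc, hFX, hFU, hFm⟩ := hX.exists_iUnion_isClosed
  have hd : Measurable fun x => v (a x) - v (b x) :=
    (hv.comp ha.continuous.measurable).sub (hv.comp hb.continuous.measurable)
  rw [← hFU, setLIntegral_iUnion_of_directed _ hFm.directed_le]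
  refine iSup_le fun n => ?_
  have hK : IsCompact (F n) := Metric.isCompact_of_isClosed_isBounded (hFc n) (hXb.subset (hFX n))
  set ψ : ℝ → ℝ := (F n).indicator fun x => if 0 ≤ v (a x) - v (b x) then 1 else -1 with hψ
  have h := integral_comp_sub_mul_le_totalVar (ψ := ψ) hv hV ha ha' hb hb' hC hK hΩ
    (fun x hx => hXΩ x (hFX n hx)) hTV
    ((Measurable.ite (measurableSet_le measurable_const hd) measurable_const
      measurable_const).indicator (hFc n).measurableSet)
    (fun x => by
      by_cases hx : x ∈ F n
      · rw [hψ, indicator_of_mem hx]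
        split_ifs <;> simp
      · rw [hψ, indicator_of_notMem hx]
        simp)
    (fun x hx => by rw [hψ, indicator_of_notMem hx])
  have e : (fun x => (v (a x) - v (b x)) * ψ x)
      = (F n).indicator fun x => ‖v (a x) - v (b x)‖ := by
    ext x
    by_cases hx : x ∈ F n
    · rw [hψ, indicator_of_mem hx, indicator_of_mem hx, Real.norm_eq_abs]
      split_ifs with h
      · rw [abs_of_nonneg h, mul_one]
      · rw [abs_of_neg (not_le.1 h), mul_neg_one]
    · rw [hψ, indicator_of_notMem hx, indicator_of_notMem hx, mul_zero]
  rw [e, integral_indicator (hFc n).measurableSet] at h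
  have hint : IntegrableOn (fun x => v (a x) - v (b x)) (F n) :=
    Measure.integrableOn_of_bounded (M := V + V) hK.measure_lt_top.ne hd.aestronglyMeasurable
      (Eventually.of_forall fun x => (abs_sub _ _).trans (add_le_add (hV _) (hV _)))
  rw [← ofReal_integral_norm_eq_lintegral_enorm hint]
  exact ENNReal.ofReal_le_ofReal h

/-! ### Representatives with bounds and regularity everywhere. -/

theorem totalVar_mono (v : ℝ → ℝ) {Ω Ω' : Set ℝ} (h : Ω ⊆ Ω') : totalVar v Ω ≤ totalVar v Ω' :=
  iSup₂_le fun φ hφ => le_iSup₂_of_le (f := fun (φ : ℝ → ℝ) (_ : ContDiff ℝ 1 φ ∧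
    HasCompactSupport φ ∧ tsupport φ ⊆ Ω' ∧ ∀ y, |φ y| ≤ 1) => ENNReal.ofReal (∫ y, v y * deriv φ y))
    φ ⟨hφ.1, hφ.2.1, hφ.2.2.1.trans h, hφ.2.2.2⟩ le_rfl

theorem totalVar_congr {v w : ℝ → ℝ} (h : v =ᵐ[volume] w) (Ω : Set ℝ) :
    totalVar v Ω = totalVar w Ω := by
  unfold totalVar
  refine iSup_congr fun φ => iSup_congr fun _ => congrArg _ (integral_congr_ae ?_)
  filter_upwards [h] with y hy
  rw [hy]

theorem ae_abs_le_toReal_eLpNorm_top {f : ℝ → ℝ} (hf : eLpNorm f ⊤ volume ≠ ⊤) :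
    ∀ᵐ y, |f y| ≤ (eLpNorm f ⊤ volume).toReal := by
  filter_upwards [ae_le_eLpNormEssSup (f := f) (μ := volume)] with y hy
  rw [← eLpNorm_exponent_top] at hy
  simpa using ENNReal.toReal_mono hf hy

/-- A measurable representative is clamped between `m` and the essential supremum norm, which
changes it only on a null set. -/
theorem MemLinfGe.exists_modification {m : ℝ} {v : ℝ → ℝ} (hv : MemLinfGe m v) :
    ∃ w : ℝ → ℝ, Measurable w ∧ v =ᵐ[volume] w ∧ (∀ y, m ≤ w y) ∧
      ∀ y, w y ≤ (eLpNorm v ⊤ volume).toReal := by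
  set V := (eLpNorm v ⊤ volume).toReal
  have hV := ae_abs_le_toReal_eLpNorm_top hv.1.2.ne
  obtain ⟨y₀, h1, h2⟩ := (hv.2.and hV).exists
  have hmV : m ≤ V := h1.trans ((le_abs_self _).trans h2)
  have hs := hv.1.1
  refine ⟨fun y => max m (min V (hs.mk v y)),
    measurable_const.max (measurable_const.min hs.stronglyMeasurable_mk.measurable), ?_,
    fun y => le_max_left _ _, fun y => max_le hmV (min_le_left _ _)⟩
  filter_upwards [hv.2, hV, hs.ae_eq_mk] with y e1 e2 e3
  rw [← e3, min_eq_right ((le_abs_self _).trans e2), max_eq_right e1]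

theorem ae_eLpNorm_le_eNormLinfLinf {T : ℝ} {f : ℝ → ℝ → ℝ} (hf : eNormLinfLinf T f < ⊤) :
    ∀ᵐ t ∂(volume.restrict (Ioo 0 T)), ∀ᵐ y, |f t y| ≤ (eNormLinfLinf T f).toReal := by
  filter_upwards [ENNReal.ae_le_essSup (μ := volume.restrict (Ioo 0 T))
    fun t => eLpNorm (f t) ⊤ volume] with t ht
  filter_upwards [ae_abs_le_toReal_eLpNorm_top (ht.trans_lt hf).ne] with y hy
  exact hy.trans (ENNReal.toReal_mono hf.ne ht)

/-- A right-hand side in `L^∞((0,T); W^{1,∞}(ℝ))` agrees at almost every time with one whose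
regularity holds at every time. -/
theorem MemLinfW1Infty.exists_modification {T : ℝ} {lam : ℝ → ℝ → ℝ} (h : MemLinfW1Infty T lam) :
    ∃ g : ℝ → ℝ → ℝ, IsCaratheodory g
        (eNormLinfLinf T (fun t => weakDeriv (lam t))).toReal.toNNReal
        (eNormLinfLinf T lam).toReal ∧
      ∀ᵐ t ∂(volume.restrict (Ioo 0 T)), ∀ y, lam t y = g t y := by
  set μ := volume.restrict (Ioo 0 T)
  set L := (eNormLinfLinf T lam).toReal
  set L₂ := (eNormLinfLinf T (fun t => weakDeriv (lam t))).toReal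
  have hL : 0 ≤ L := ENNReal.toReal_nonneg
  -- Measurability in time is known only pointwise in `y`, with an exceptional set depending on `y`.
  -- Rational `y` give countably many such sets; real `y` follow by continuity in space.
  let q : ℚ → ℝ → ℝ := fun r => (h.measurable r).mk _
  have hq : ∀ r, Measurable (q r) := fun r => (h.measurable r).stronglyMeasurable_mk.measurable
  have hae : ∀ᵐ t ∂μ, (∀ y, |lam t y| ≤ L) ∧ LipschitzWith L₂.toNNReal (lam t) ∧
      ∀ r : ℚ, lam t r = q r t := by
    filter_upwards [h.memW1Infty, ae_eLpNorm_le_eNormLinfLinf h.bounded,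
      ae_eLpNorm_le_eNormLinfLinf h.bounded_deriv,
      ae_all_iff.2 fun r : ℚ => (h.measurable r).ae_eq_mk] with t h1 h2 h3 h4
    obtain ⟨hc, -, d, hd, -⟩ := h1
    refine ⟨fun y => ?_, hd.weakDeriv.lipschitzWith hc ?_, h4⟩
    · have hcl : IsClosed {y | |lam t y| ≤ L} := isClosed_le hc.abs continuous_const
      -- A closed set of full Lebesgue measure is the whole line.
      have := (Measure.dense_of_ae h2).closure_eq ▸ hcl.closure_eq
      exact (this ▸ mem_univ y : y ∈ {y | |lam t y| ≤ L})
    · filter_upwards [h3] with y hy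
      rwa [Real.coe_toNNReal _ ENNReal.toReal_nonneg]
  set N := toMeasurable μ {t | ¬ ((∀ y, |lam t y| ≤ L) ∧ LipschitzWith L₂.toNNReal (lam t) ∧
      ∀ r : ℚ, lam t r = q r t)}
  have hN : MeasurableSet N := measurableSet_toMeasurable _ _
  have hN0 : μ N = 0 := by rw [measure_toMeasurable]; exact hae
  have hgood : ∀ t, t ∉ N → (∀ y, |lam t y| ≤ L) ∧ LipschitzWith L₂.toNNReal (lam t) ∧
      ∀ r : ℚ, lam t r = q r t := by
    intro t ht
    by_contra hn
    exact ht (subset_toMeasurable _ _ hn)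
  classical
  have hlip : ∀ t, LipschitzWith L₂.toNNReal fun y => if t ∈ N then 0 else lam t y := by
    intro t
    by_cases ht : t ∈ N
    · simpa [ht] using LipschitzWith.const' (0 : ℝ)
    · simpa [ht] using (hgood t ht).2.1
  refine ⟨fun t y => if t ∈ N then 0 else lam t y, ⟨fun y => ?_, hlip, fun t y => ?_⟩, ?_⟩
  · have hrat : ∀ r : ℚ, Measurable fun t => if t ∈ N then (0 : ℝ) else lam t r := by
      intro r
      have : (fun t => if t ∈ N then (0 : ℝ) else lam t r)
          = fun t => if t ∈ N then (0 : ℝ) else q r t := by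
        ext t
        split_ifs with ht
        · rfl
        · exact (hgood t ht).2.2 r
      rw [this]
      exact Measurable.ite hN measurable_const (hq r)
    obtain ⟨u, hu, hlim⟩ := mem_closure_iff_seq_limit.1 (Rat.denseRange_cast (𝕜 := ℝ) y)
    choose p hp using hu
    refine measurable_of_tendsto_metrizable (f := fun n t => if t ∈ N then (0 : ℝ) else lam t (u n))
      (fun n => by rw [← hp n]; exact hrat (p n)) ?_
    rw [tendsto_pi_nhds]
    intro t
    exact ((hlip t).continuous.tendsto y).comp hlim
  · by_cases ht : t ∈ N
    · simpa [ht] using hL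
    · simpa [ht] using (hgood t ht).1 y
  · have : ∀ᵐ t ∂μ, t ∉ N := measure_eq_zero_iff_ae_notMem.1 hN0
    filter_upwards [this] with t ht y
    simp [ht]

theorem integral_congr_of_ae_Ioo {T : ℝ} {lam g : ℝ → ℝ → ℝ}
    (h : ∀ᵐ t ∂(volume.restrict (Ioo 0 T)), ∀ y, lam t y = g t y) (x : ℝ → ℝ) {t : ℝ}
    (ht : t ∈ Icc 0 T) : ∫ s in (0 : ℝ)..t, lam s (x s) = ∫ s in (0 : ℝ)..t, g s (x s) := by
  rw [intervalIntegral.integral_of_le ht.1, intervalIntegral.integral_of_le ht.1]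
  refine integral_congr_ae ?_
  rw [Measure.restrict_congr_set Ioo_ae_eq_Ioc] at h
  filter_upwards [ae_restrict_of_ae_restrict_of_subset (Ioc_subset_Ioc_right ht.2) h] with s hs
  exact hs _

/-! ### Continuity of composition in L¹_loc. -/

/-- Composition with maps whose image measures are uniformly controlled is continuous in `L¹_loc`
under uniform convergence of the maps. -/
theorem tendsto_lintegral_comp_sub {ι : Type*} {l : Filter ι} {a : ι → ℝ → ℝ} {b : ℝ → ℝ}
    {C : ℝ≥0} {w : ℝ → ℝ} {W : ℝ} (hw : Measurable w) (hW : ∀ y, |w y| ≤ W)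
    (ha : ∀ᶠ i in l, Measurable (a i) ∧ volume.map (a i) ≤ C • volume)
    (hb : Continuous b) (hbC : volume.map b ≤ C • volume) (hlim : TendstoUniformly a b l)
    {K : Set ℝ} (hK : IsCompact K) :
    Tendsto (fun i => ∫⁻ x in K, ‖w (a i x) - w (b x)‖ₑ) l (𝓝 0) := by
  rw [ENNReal.tendsto_nhds_zero]
  intro η hη
  set c : ℝ≥0∞ := C + volume K + C with hc
  have hc' : c ≠ ⊤ := by
    simp [hc, hK.measure_lt_top.ne]
  obtain ⟨ε, hε, hεη⟩ := ENNReal.exists_nnreal_pos_mul_lt hc' hη.ne'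
  have hε' : (ε : ℝ≥0∞) ≠ 0 := by simpa using hε.ne'
  -- A compact set containing b(K) and eventually a_i(K): cutting `w` off outside it makes `w`
  -- integrable without changing either composition on `K`.
  set B := Metric.cthickening 1 (b '' K)
  have hB : IsCompact B := (hK.image hb).cthickening
  have hBm : MeasurableSet B := hB.measurableSet
  have hu : Integrable (B.indicator w) :=
    (Measure.integrableOn_of_bounded (M := W) hB.measure_lt_top.ne hw.aestronglyMeasurable
      (Eventually.of_forall fun y => by simpa using hW y)).integrable_indicator hBm
  obtain ⟨g, hgc, hgu, hg, -⟩ := hu.exists_hasCompactSupport_lintegral_sub_le hε'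
  have hguc := hgc.uniformContinuous_of_continuous hg
  have hmeas : Measurable fun y => ‖B.indicator w y - g y‖ₑ :=
    ((hw.indicator hBm).sub hg.measurable).enorm
  have hcomp : ∀ e : ℝ → ℝ, Measurable e → volume.map e ≤ C • volume → (∀ x ∈ K, e x ∈ B) →
      ∫⁻ x in K, ‖w (e x) - g (e x)‖ₑ ≤ C * ε := by
    intro e he heC heB
    calc ∫⁻ x in K, ‖w (e x) - g (e x)‖ₑ
        = ∫⁻ x in K, ‖B.indicator w (e x) - g (e x)‖ₑ :=
          setLIntegral_congr_fun hK.measurableSet fun x hx => by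
            simp only [indicator_of_mem (heB x hx)]
      _ ≤ ∫⁻ x, ‖B.indicator w (e x) - g (e x)‖ₑ := setLIntegral_le_lintegral _ _
      _ = ∫⁻ y, ‖B.indicator w y - g y‖ₑ ∂(volume.map e) := (lintegral_map hmeas he).symm
      _ ≤ ∫⁻ y, ‖B.indicator w y - g y‖ₑ ∂(C • volume) := lintegral_mono' heC le_rfl
      _ = C * ∫⁻ y, ‖B.indicator w y - g y‖ₑ := by
          rw [lintegral_smul_measure]; rfl
      _ ≤ C * ε := by gcongr
  have hbB : ∀ x ∈ K, b x ∈ B := fun x hx =>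
    Metric.self_subset_cthickening _ (mem_image_of_mem b hx)
  have hgd := hguc.comp_tendstoUniformly hlim
  rw [Metric.tendstoUniformly_iff] at hlim hgd
  filter_upwards [ha, hlim 1 one_pos, hgd ε (by exact_mod_cast hε)] with i hi h1 h2
  have haB : ∀ x ∈ K, a i x ∈ B := fun x hx =>
    Metric.mem_cthickening_of_dist_le _ (b x) _ _ (mem_image_of_mem b hx)
      (by rw [dist_comm]; exact (h1 x).le)
  have hm1 : Measurable fun x => ‖w (a i x) - g (a i x)‖ₑ :=
    ((hw.comp hi.1).sub (hg.measurable.comp hi.1)).enorm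
  have hm2 : Measurable fun x => ‖g (a i x) - g (b x)‖ₑ :=
    ((hg.measurable.comp hi.1).sub (hg.measurable.comp hb.measurable)).enorm
  calc ∫⁻ x in K, ‖w (a i x) - w (b x)‖ₑ
      ≤ ∫⁻ x in K, (‖w (a i x) - g (a i x)‖ₑ + ‖g (a i x) - g (b x)‖ₑ
          + ‖w (b x) - g (b x)‖ₑ) := by
        refine lintegral_mono fun x => ?_
        have : w (a i x) - w (b x) = (w (a i x) - g (a i x)) + (g (a i x) - g (b x))
          - (w (b x) - g (b x)) := by ring
        simp only [this]
        exact (enorm_sub_le).trans (add_le_add_left (enorm_add_le _ _) _)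
    _ = (∫⁻ x in K, ‖w (a i x) - g (a i x)‖ₑ) + (∫⁻ x in K, ‖g (a i x) - g (b x)‖ₑ)
          + ∫⁻ x in K, ‖w (b x) - g (b x)‖ₑ := by
        rw [lintegral_add_left (f := fun x => ‖w (a i x) - g (a i x)‖ₑ + ‖g (a i x) - g (b x)‖ₑ)
          (hm1.add hm2), lintegral_add_left hm1]
    _ ≤ C * ε + ε * volume K + C * ε := by
        refine add_le_add (add_le_add (hcomp _ hi.1 hi.2 haB) ?_)
          (hcomp _ hb.measurable hbC hbB)
        rw [← setLIntegral_const]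
        refine lintegral_mono fun x => ?_
        have := h2 x
        simp only [Function.comp_apply] at this
        rw [dist_comm, Real.dist_eq, ← Real.norm_eq_abs] at this
        rw [enorm_le_coe]
        exact_mod_cast this.le
    _ = ε * c := by rw [hc]; ring
    _ ≤ η := hεη.le

/-! ### The flow in the original variable. -/

/-- The flow in the original variable, together with the straightened flow: `G` is the primitive
of `1 / w`, and `Z` solves the equation with right-hand side `g s (G.symm z)`. -/
structure IsFlow (T m V L : ℝ) (L₂ : ℝ≥0) (w : ℝ → ℝ) (g : ℝ → ℝ → ℝ) (G : ℝ ≃o ℝ)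
    (Z : ℝ → ℝ → ℝ) : Prop where
  measurable : Measurable w
  pos : 0 < m
  lower : ∀ y, m ≤ w y
  upper : ∀ y, w y ≤ V
  caratheodory : IsCaratheodory g L₂ L
  integral_eq : ∀ a b, ∫ y in a..b, 1 / w y = G b - G a
  lipschitz : LipschitzWith (1 / m).toNNReal G
  lipschitz_symm : LipschitzWith V.toNNReal G.symm
  ae_hasDerivAt : ∀ᵐ x, HasDerivAt G (1 / w x) x
  continuous : ∀ z, Continuous fun t => Z t z
  eq_add_integral : ∀ t z, Z t z = z + ∫ s in (0 : ℝ)..t, g s (G.symm (Z s z))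

namespace IsFlow

variable {T m V L : ℝ} {L₂ : ℝ≥0} {w : ℝ → ℝ} {g : ℝ → ℝ → ℝ} {G : ℝ ≃o ℝ} {Z : ℝ → ℝ → ℝ}

theorem caratheodory_comp (h : IsFlow T m V L L₂ w g G Z) :
    IsCaratheodory (fun s z => g s (G.symm z)) (L₂ * V.toNNReal) L :=
  ⟨fun _ => h.caratheodory.measurable _, fun s => (h.caratheodory.lipschitz s).comp h.lipschitz_symm,
    fun s _ => h.caratheodory.bound s _⟩

theorem V_pos (h : IsFlow T m V L L₂ w g G Z) : 0 < V :=
  h.pos.trans_le ((h.lower 0).trans (h.upper 0))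

theorem abs_le (h : IsFlow T m V L L₂ w g G Z) (y : ℝ) : |w y| ≤ V := by
  rw [abs_of_pos (h.pos.trans_le (h.lower y))]
  exact h.upper y

theorem coe_rate (h : IsFlow T m V L L₂ w g G Z) : ((L₂ * V.toNNReal : ℝ≥0) : ℝ) = L₂ * V := by
  rw [NNReal.coe_mul, Real.coe_toNNReal _ h.V_pos.le]

theorem abs_symm_sub_le (h : IsFlow T m V L L₂ w g G Z) (z z' : ℝ) :
    |G.symm z - G.symm z'| ≤ V * |z - z'| := by
  have := h.lipschitz_symm.dist_le_mul z z'
  rwa [Real.dist_eq, Real.dist_eq, Real.coe_toNNReal _ h.V_pos.le] at this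

/-- The flow map at a fixed time is a bi-Lipschitz increasing bijection. -/
theorem exists_orderIso (h : IsFlow T m V L L₂ w g G Z) {t : ℝ} (ht : t ∈ Icc 0 T) :
    ∃ ζ a : ℝ ≃o ℝ, (∀ z, ζ z = Z t z) ∧ (∀ x, a x = G.symm (Z t (G x))) ∧
      LipschitzWith (Real.exp (L₂ * V * T)).toNNReal ζ ∧
      LipschitzWith (Real.exp (L₂ * V * T)).toNNReal ζ.symm ∧
      LipschitzWith (V * Real.exp (L₂ * V * T) / m).toNNReal a ∧
      LipschitzWith (V * Real.exp (L₂ * V * T) / m).toNNReal a.symm := by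
  obtain ⟨ζ, h1, h2, h3⟩ := h.caratheodory_comp.exists_orderIso_flow h.continuous
    h.eq_add_integral ht
  rw [h.coe_rate] at h2 h3
  have hK : V.toNNReal * (Real.exp (L₂ * V * T)).toNNReal * (1 / m).toNNReal
      = (V * Real.exp (L₂ * V * T) / m).toNNReal := by
    rw [← Real.toNNReal_mul h.V_pos.le,
      ← Real.toNNReal_mul (mul_nonneg h.V_pos.le (Real.exp_pos _).le), mul_one_div]
  refine ⟨ζ, (G.trans ζ).trans G.symm, h1, fun x => ?_, h2, h3, ?_, ?_⟩
  · simp [h1]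
  · rw [← hK]
    exact (h.lipschitz_symm.comp h2).comp h.lipschitz
  · rw [← hK]
    exact (h.lipschitz_symm.comp h3).comp h.lipschitz

theorem abs_time_sub_le (h : IsFlow T m V L L₂ w g G Z) (t t' x : ℝ) :
    |G.symm (Z t (G x)) - G.symm (Z t' (G x))| ≤ V * (L * |t - t'|) :=
  (h.abs_symm_sub_le _ _).trans (mul_le_mul_of_nonneg_left
    (h.caratheodory_comp.abs_flow_time_sub_le h.continuous h.eq_add_integral t t' _) h.V_pos.le)

/-- The speed is at most V L, so no point moves farther than V T L; this is the radius of the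
neighbourhood on which the variation is measured. -/
theorem abs_sub_self_le (h : IsFlow T m V L L₂ w g G Z) {t : ℝ} (ht : t ∈ Icc 0 T) (x : ℝ) :
    |G.symm (Z t (G x)) - x| ≤ V * T * L := by
  have h0 : Z 0 (G x) = G x := by simpa using h.eq_add_integral 0 (G x)
  have := h.abs_time_sub_le t 0 x
  rw [h0, G.symm_apply_apply, sub_zero, abs_of_nonneg ht.1] at this
  refine this.trans ?_
  have h1 := ht.2
  have h2 := h.V_pos
  have h3 := h.caratheodory.nonneg
  calc V * (L * t) ≤ V * (L * T) := by gcongr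
    _ = V * T * L := by ring

/-- With p, q the values of `w` at the two image points and ζ, ξ the straightened flow maps, pζ' −
qξ' = p(ζ' − ξ') + (p − q)ξ'. The Lipschitz constants of ζ − ξ and ξ bound the derivatives, and
division by `w x` costs 1/m. -/
theorem ae_abs_deriv_sub_le (h : IsFlow T m V L L₂ w g G Z) {t t' : ℝ} (ht : t ∈ Icc 0 T)
    (ht' : t' ∈ Icc 0 T) :
    ∀ᵐ x, |deriv (fun x => G.symm (Z t (G x))) x - deriv (fun x => G.symm (Z t' (G x))) x| ≤
      V / m * (L₂ * V * Real.exp (L₂ * V * T) * |t - t'|) +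
      Real.exp (L₂ * V * T) / m * |w (G.symm (Z t (G x))) - w (G.symm (Z t' (G x)))| := by
  obtain ⟨ζ, -, hζ, -, l1, l1', -⟩ := h.exists_orderIso ht
  obtain ⟨ξ, -, hξ, -, l2, l2', -⟩ := h.exists_orderIso ht'
  have hpos : ∀ y, 0 < w y := fun y => h.pos.trans_le (h.lower y)
  have hV := h.V_pos
  have hm := h.pos
  set E := Real.exp (L₂ * V * T)
  set D : ℝ := L₂ * V * E * |t - t'|
  have hE : 0 < E := Real.exp_pos _
  have hD : 0 ≤ D := by positivity
  have hdiff : LipschitzWith D.toNNReal (fun z => ζ z - ξ z) := by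
    refine LipschitzWith.of_dist_le_mul fun z z' => ?_
    rw [Real.dist_eq, Real.dist_eq, Real.coe_toNNReal _ hD, hζ, hζ, hξ, hξ]
    have := h.caratheodory_comp.abs_flow_double_sub_le h.continuous h.eq_add_integral ht ht' z z'
    rwa [h.coe_rate] at this
  filter_upwards [ae_hasDerivAt_conj hpos h.lipschitz h.lipschitz_symm h.ae_hasDerivAt l1 l1',
    ae_hasDerivAt_conj hpos h.lipschitz h.lipschitz_symm h.ae_hasDerivAt l2 l2',
    ae_comp h.lipschitz_symm G.symm_apply_apply l1.ae_differentiableAt_real,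
    ae_comp h.lipschitz_symm G.symm_apply_apply l2.ae_differentiableAt_real] with x d1 d2 e1 e2
  simp only [hζ, hξ] at d1 d2
  rw [d1.deriv, d2.deriv]
  have b1 : |deriv ζ (G x) - deriv ξ (G x)| ≤ D := by
    have := (e1.hasDerivAt.sub e2.hasDerivAt).le_of_lipschitz hdiff
    rwa [Real.norm_eq_abs, Real.coe_toNNReal _ hD] at this
  have b2 : |deriv ξ (G x)| ≤ E := by
    have := norm_deriv_le_of_lipschitz l2 (x₀ := G x)
    rwa [Real.norm_eq_abs, Real.coe_toNNReal _ hE.le] at this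
  set p := w (G.symm (Z t (G x)))
  set q := w (G.symm (Z t' (G x)))
  have hp : |p| ≤ V := h.abs_le _
  have e : p * deriv ζ (G x) / w x - q * deriv ξ (G x) / w x
      = (p * (deriv ζ (G x) - deriv ξ (G x)) + (p - q) * deriv ξ (G x)) / w x := by ring
  rw [e, abs_div, abs_of_pos (hpos x)]
  have hnum : |p * (deriv ζ (G x) - deriv ξ (G x)) + (p - q) * deriv ξ (G x)|
      ≤ V * D + |p - q| * E := by
    refine (abs_add_le _ _).trans ?_
    rw [abs_mul, abs_mul]
    gcongr
  calc _ ≤ (V * D + |p - q| * E) / m := by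
        have := h.lower x
        gcongr
    _ = _ := by ring

theorem lintegral_deriv_sub_le (h : IsFlow T m V L L₂ w g G Z) {t t' : ℝ} (ht : t ∈ Icc 0 T)
    (ht' : t' ∈ Icc 0 T) (X : Set ℝ) :
    ∫⁻ x in X, ‖deriv (fun x => G.symm (Z t (G x))) x - deriv (fun x => G.symm (Z t' (G x))) x‖ₑ ≤
      ENNReal.ofReal (V / m * (L₂ * V * Real.exp (L₂ * V * T) * |t - t'|)) * volume X +
      ENNReal.ofReal (Real.exp (L₂ * V * T) / m) *
        ∫⁻ x in X, ‖w (G.symm (Z t (G x))) - w (G.symm (Z t' (G x)))‖ₑ := by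
  have hV := h.V_pos
  have hm := h.pos
  rw [← setLIntegral_const, ← lintegral_const_mul' _ _ ENNReal.ofReal_ne_top,
    ← lintegral_add_left measurable_const]
  refine lintegral_mono_ae (ae_restrict_of_ae ?_)
  filter_upwards [h.ae_abs_deriv_sub_le ht ht'] with x hx
  rw [← ofReal_norm, ← ofReal_norm, Real.norm_eq_abs, Real.norm_eq_abs,
    ← ENNReal.ofReal_mul (by positivity), ← ENNReal.ofReal_add (by positivity) (by positivity)]
  exact ENNReal.ofReal_le_ofReal hx

theorem lipschitzWith (h : IsFlow T m V L L₂ w g G Z) {t : ℝ} (ht : t ∈ Icc 0 T) :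
    LipschitzWith (V * Real.exp (L₂ * V * T) / m).toNNReal fun x => G.symm (Z t (G x)) := by
  obtain ⟨-, a, -, ha, -, -, l, -⟩ := h.exists_orderIso ht
  simpa only [← ha] using l

theorem map_le (h : IsFlow T m V L L₂ w g G Z) {t : ℝ} (ht : t ∈ Icc 0 T) :
    volume.map (fun x => G.symm (Z t (G x)))
      ≤ (V * Real.exp (L₂ * V * T) / m).toNNReal • volume := by
  obtain ⟨-, a, -, ha, -, -, l, l'⟩ := h.exists_orderIso ht
  simpa only [← ha] using map_volume_le l.continuous.measurable l' a.symm_apply_apply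

theorem tendsto_lintegral_deriv_sub (h : IsFlow T m V L L₂ w g G Z) {t' : ℝ} (ht' : t' ∈ Icc 0 T)
    {K : Set ℝ} (hK : IsCompact K) :
    Tendsto (fun t => ∫⁻ x in K,
      ‖deriv (fun x => G.symm (Z t (G x))) x - deriv (fun x => G.symm (Z t' (G x))) x‖ₑ)
      (𝓝[Icc 0 T] t') (𝓝 0) := by
  have habs : Tendsto (fun t => |t - t'|) (𝓝[Icc 0 T] t') (𝓝 0) := by
    have : Tendsto (fun t => |t - t'|) (𝓝 t') (𝓝 |t' - t'|) :=
      (by fun_prop : Continuous fun t : ℝ => |t - t'|).tendsto t'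
    rw [sub_self, abs_zero] at this
    exact this.mono_left nhdsWithin_le_nhds
  have hunif : TendstoUniformly (fun t x => G.symm (Z t (G x))) (fun x => G.symm (Z t' (G x)))
      (𝓝[Icc 0 T] t') := by
    rw [Metric.tendstoUniformly_iff]
    intro ε hε
    have h1 : Tendsto (fun t => V * (L * |t - t'|)) (𝓝[Icc 0 T] t') (𝓝 0) := by
      simpa using (habs.const_mul L).const_mul V
    filter_upwards [h1.eventually_lt_const hε] with t ht x
    rw [dist_comm, Real.dist_eq]
    exact (h.abs_time_sub_le t t' x).trans_lt ht
  have h2 := tendsto_lintegral_comp_sub h.measurable h.abs_le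
    (by
      filter_upwards [self_mem_nhdsWithin] with t ht
      exact ⟨(h.lipschitzWith ht).continuous.measurable, h.map_le ht⟩)
    (h.lipschitzWith ht').continuous (h.map_le ht') hunif hK
  have h3 : Tendsto (fun t => ENNReal.ofReal
      (V / m * (L₂ * V * Real.exp (L₂ * V * T) * |t - t'|)) * volume K) (𝓝[Icc 0 T] t') (𝓝 0) := by
    have := ENNReal.tendsto_ofReal
      ((habs.const_mul (L₂ * V * Real.exp (L₂ * V * T))).const_mul (V / m))
    have := ENNReal.Tendsto.mul_const (b := volume K) this (Or.inr hK.measure_lt_top.ne)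
    simpa only [mul_zero, ENNReal.ofReal_zero, zero_mul] using this
  have h4 := ENNReal.Tendsto.const_mul (a := ENNReal.ofReal (Real.exp (L₂ * V * T) / m)) h2
    (Or.inr ENNReal.ofReal_ne_top)
  have h5 := h3.add h4
  rw [mul_zero, add_zero] at h5
  refine tendsto_of_tendsto_of_tendsto_of_le_of_le' tendsto_const_nhds h5
    (Eventually.of_forall fun _ => zero_le) ?_
  filter_upwards [self_mem_nhdsWithin] with t ht
  exact h.lintegral_deriv_sub_le ht ht' K

theorem lintegral_comp_sub_le (h : IsFlow T m V L L₂ w g G Z) {t t' : ℝ} (ht : t ∈ Icc 0 T)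
    (ht' : t' ∈ Icc 0 T) {X Ω : Set ℝ} (hX : IsOpen X) (hXb : Bornology.IsBounded X)
    (hΩ : IsOpen Ω) (hXΩ : ∀ x ∈ X, ∀ y, |y - x| ≤ V * T * L → y ∈ Ω) (hTV : totalVar w Ω ≠ ⊤) :
    ∫⁻ x in X, ‖w (G.symm (Z t (G x))) - w (G.symm (Z t' (G x)))‖ₑ ≤
      ENNReal.ofReal (V * Real.exp (L₂ * V * T) / m * (V * (L * |t - t'|))
        * (totalVar w Ω).toReal) := by
  obtain ⟨-, a, -, ha, -, -, la, la'⟩ := h.exists_orderIso ht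
  obtain ⟨-, b, -, hb, -, -, lb, lb'⟩ := h.exists_orderIso ht'
  have hV := h.V_pos
  have hm := h.pos
  simp only [← ha, ← hb]
  refine lintegral_comp_sub_le_totalVar h.measurable h.abs_le la la' lb lb' (fun y => ?_) hX hXb hΩ
    (fun x hx y hy => hXΩ x hx y ?_) hTV
  -- For u = a⁻¹(y), a⁻¹(y) − b⁻¹(y) = b⁻¹(b(u)) − b⁻¹(a(u)). The Lipschitz constant of b⁻¹ supplies
  -- the second factor exp(L₂VT)/m of the final bound.
  · have h1 := lb'.dist_le_mul (b (a.symm y)) (a (a.symm y))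
    rw [b.symm_apply_apply, a.apply_symm_apply, Real.dist_eq, Real.dist_eq,
      Real.coe_toNNReal _ (by positivity)] at h1
    refine h1.trans (mul_le_mul_of_nonneg_left ?_ (by positivity))
    have h2 := h.abs_time_sub_le t t' (a.symm y)
    rwa [← ha, ← hb, a.apply_symm_apply, abs_sub_comm] at h2
  · have h1 := h.abs_sub_self_le ht x
    have h2 := h.abs_sub_self_le ht' x
    rw [← ha, _root_.abs_le] at h1
    rw [← hb, _root_.abs_le] at h2
    rw [_root_.abs_le]
    rw [mem_uIcc] at hy
    rcases hy with hy | hy <;> constructor <;> linarith [hy.1, hy.2]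

end IsFlow

/-! ### Existence of the flow and the final estimates. -/

/-- The open interval excludes displacements of length exactly `r`, but as `X` is open the base
point can be moved slightly towards `y`. For r = 0 the scaled interval is {0}, not empty. -/
theorem mem_add_smul_Ioo {X : Set ℝ} (hX : IsOpen X) {r x y : ℝ} (hr : 0 ≤ r) (hx : x ∈ X)
    (hy : |y - x| ≤ r) : y ∈ X + r • Ioo (-1 : ℝ) 1 := by
  rcases hr.eq_or_lt with rfl | hr
  · have : y = x := by simpa [sub_eq_zero] using hy
    exact ⟨x, hx, 0, ⟨0, by simp, by simp⟩, by simp [this]⟩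
  · obtain ⟨ε, hε, hball⟩ := Metric.isOpen_iff.1 hX x hx
    set s := min (1 / 2) (ε / (2 * r)) with hs
    have hs0 : 0 < s := lt_min (by norm_num) (by positivity)
    have hs1 : s ≤ 1 / 2 := min_le_left _ _
    have hsr : s * r < ε := by
      have : s ≤ ε / (2 * r) := min_le_right _ _
      rw [le_div_iff₀ (by positivity)] at this
      linarith
    refine ⟨x + s * (y - x), hball ?_, (1 - s) * (y - x), ⟨(1 - s) * (y - x) / r, ?_, ?_⟩, ?_⟩
    · rw [Metric.mem_ball, Real.dist_eq, add_sub_cancel_left, abs_mul, abs_of_pos hs0]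
      exact (mul_le_mul_of_nonneg_left hy hs0.le).trans_lt hsr
    · rw [mem_Ioo, ← abs_lt, abs_div, abs_of_pos hr, div_lt_one hr, abs_mul,
        abs_of_pos (by linarith : 0 < 1 - s)]
      calc (1 - s) * |y - x| ≤ (1 - s) * r := mul_le_mul_of_nonneg_left hy (by linarith)
        _ < r := by nlinarith
    · simp only [smul_eq_mul]
      field_simp
    · simp only
      ring

theorem totalVar_lt_top {v : ℝ → ℝ} (hv : MemTVloc v) {Ω : Set ℝ} (hΩ : Bornology.IsBounded Ω) :
    totalVar v Ω < ⊤ :=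
  (totalVar_mono v subset_closure).trans_lt (hv _ hΩ.isCompact_closure)

theorem isBounded_add_smul_Ioo {X : Set ℝ} (hX : Bornology.IsBounded X) (r : ℝ) :
    Bornology.IsBounded (X + r • Ioo (-1 : ℝ) 1) :=
  hX.add ((Metric.isBounded_Ioo (-1 : ℝ) 1).smul₀ r)

/-- The straightened flow exists, and it describes all solutions of the original equation. -/
theorem exists_isFlow {T m : ℝ} (hT : 0 ≤ T) (hm : 0 < m) {v : ℝ → ℝ} {lam : ℝ → ℝ → ℝ}
    (hv : MemLinfGe m v) (hlam : MemLinfW1Infty T lam) :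
    ∃ w g G Z, v =ᵐ[volume] w ∧
      IsFlow T m (eLpNorm v ⊤ volume).toReal (eNormLinfLinf T lam).toReal
        (eNormLinfLinf T (fun t => weakDeriv (lam t))).toReal.toNNReal w g G Z ∧
      ∀ x₀, IsSolution T v lam x₀ (fun t => G.symm (Z t (G x₀))) ∧
        ∀ x, IsSolution T v lam x₀ x → EqOn x (fun t => G.symm (Z t (G x₀))) (Icc 0 T) := by
  obtain ⟨w, hw, hvw, h1, h2⟩ := hv.exists_modification
  obtain ⟨g, hg, hlg⟩ := hlam.exists_modification
  obtain ⟨G, i1, i2, i3, i4⟩ := exists_orderIso_primitive hm hw h1 h2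
  set V := (eLpNorm v ⊤ volume).toReal
  have hf : IsCaratheodory (fun s z => g s (G.symm z)) (_ * V.toNNReal) _ :=
    ⟨fun _ => hg.measurable _, fun s => (hg.lipschitz s).comp i3, fun s _ => hg.bound s _⟩
  choose z hz1 hz2 using hf.exists_solution
  have hsol : ∀ x₀ x, IsSolution T v lam x₀ x ↔ ContinuousOn x (Icc 0 T) ∧
      ∀ t ∈ Icc 0 T, G (x t) = G x₀ + ∫ s in (0 : ℝ)..t, g s (x s) := by
    intro x₀ x
    refine and_congr_right fun _ => forall₂_congr fun t ht => ?_
    have e : ∫ y in x₀..x t, 1 / v y = ∫ y in x₀..x t, 1 / w y := by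
      refine intervalIntegral.integral_congr_ae ?_
      filter_upwards [hvw] with y hy _
      rw [hy]
    rw [e, i1, integral_congr_of_ae_Ioo hlg x ht, sub_eq_iff_eq_add']
  refine ⟨w, g, G, fun t x => z x t, hvw, ⟨hw, hm, h1, h2, hg, i1, i2, i3, i4, hz1,
    fun t x => hz2 x t⟩, fun x₀ => ⟨?_, fun x hx => ?_⟩⟩
  · rw [hsol]
    refine ⟨(i3.continuous.comp (hz1 _)).continuousOn, fun t _ => ?_⟩
    rw [G.apply_symm_apply]
    exact hz2 _ t
  · rw [hsol] at hx
    -- A solution is continuous only on [0, T]; constant extension beyond the endpoints gives the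
    -- globally continuous function that the stability estimate requires.
    set y := IccExtend hT ((Icc 0 T).domRestrict fun t => G (x t)) with hy
    have hyc : Continuous y :=
      (i2.continuous.comp_continuousOn hx.1).domRestrict.Icc_extend'
    have hyx : ∀ t ∈ Icc 0 T, y t = G (x t) := fun t ht => IccExtend_of_mem hT _ ht
    have hyeq : ∀ t ∈ Icc 0 T, y t = G x₀ + ∫ s in (0 : ℝ)..t, g s (G.symm (y s)) := by
      intro t ht
      rw [hyx t ht, hx.2 t ht]
      congr 1
      refine intervalIntegral.integral_congr fun s hs => ?_
      rw [uIcc_of_le ht.1] at hs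
      simp only [hyx s ⟨hs.1, hs.2.trans ht.2⟩, G.symm_apply_apply]
    intro t ht
    have := hf.abs_sub_le_exp hyc (hz1 (G x₀)) hyeq (fun t _ => hz2 _ t) t ht
    rw [sub_self, abs_zero, zero_mul, hyx t ht] at this
    simp only
    rw [← sub_eq_zero.1 (abs_nonpos_iff.1 this), G.symm_apply_apply]

end DiscODE

theorem mainTheorem5 (T vlow : ℝ) (hT : 0 < T) (hvlow : 0 < vlow)
    (v : ℝ → ℝ) (lam : ℝ → ℝ → ℝ)
    (hv : DiscODE.MemLinfGe vlow v) (hlam : DiscODE.MemLinfW1Infty T lam) :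
    -- the solution exists and is unique for every initial datum
    (∀ x₀ : ℝ, DiscODE.IsSolution T v lam x₀ (DiscODE.flow T v lam x₀) ∧
      ∀ x : ℝ → ℝ, DiscODE.IsSolution T v lam x₀ x →
        EqOn x (DiscODE.flow T v lam x₀) (Icc 0 T)) ∧
    -- its derivative with respect to the initial datum exists and is locally integrable
    (∀ t ∈ Icc 0 T, DiscODE.HasWeakDeriv (fun y => DiscODE.flow T v lam y t)
      (DiscODE.flowDeriv T v lam t)) ∧
    -- continuity in time with values in `L¹_loc`
    (∀ t' ∈ Icc 0 T, ∀ K : Set ℝ, IsCompact K →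
      Tendsto
        (fun t => eLpNorm (DiscODE.flowDeriv T v lam t - DiscODE.flowDeriv T v lam t') 1
          (volume.restrict K))
        (𝓝[Icc 0 T] t') (𝓝 0)) ∧
    -- Lipschitz continuity in time if `v` has locally bounded total variation
    (DiscODE.MemTVloc v →
      ∀ V L L₂ : ℝ,
        V = (eLpNorm v ⊤ volume).toReal →
        L = (DiscODE.eNormLinfLinf T lam).toReal →
        L₂ = (DiscODE.eNormLinfLinf T (fun t => DiscODE.weakDeriv (lam t))).toReal →
      ∀ t ∈ Icc 0 T, ∀ t' ∈ Icc 0 T, ∀ X : Set ℝ, IsOpen X → Bornology.IsBounded X →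
        DiscODE.totalVar v (X + (V * T * L) • Ioo (-1 : ℝ) 1) < ⊤ ∧
        eLpNorm (DiscODE.flowDeriv T v lam t - DiscODE.flowDeriv T v lam t') 1
            (volume.restrict X) ≤
          ENNReal.ofReal
            (|t - t'| * V ^ 2 * Real.exp (T * L₂ * V) / vlow *
              (L₂ * (volume X).toReal +
                L / vlow * Real.exp (T * L₂ * V) *
                  (DiscODE.totalVar v (X + (V * T * L) • Ioo (-1 : ℝ) 1)).toReal))) := by
  obtain ⟨w, g, G, Z, hvw, hF, hsol⟩ := DiscODE.exists_isFlow hT.le hvlow hv hlam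
  set V' := (eLpNorm v ⊤ volume).toReal
  set L' := (DiscODE.eNormLinfLinf T lam).toReal
  set L₂' := (DiscODE.eNormLinfLinf T (fun t => DiscODE.weakDeriv (lam t))).toReal
  have hL₂ : ((L₂'.toNNReal : NNReal) : ℝ) = L₂' := Real.coe_toNNReal _ ENNReal.toReal_nonneg
  have hflow : ∀ x₀, DiscODE.IsSolution T v lam x₀ (DiscODE.flow T v lam x₀) := by
    intro x₀
    have h : ∃ x, DiscODE.IsSolution T v lam x₀ x := ⟨_, (hsol x₀).1⟩
    unfold DiscODE.flow
    rw [dif_pos h]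
    exact h.choose_spec
  -- `flow` is an arbitrary choice of solution; uniqueness identifies it with the explicit formula
  -- on [0, T].
  have heq : ∀ t ∈ Icc 0 T, (fun y => DiscODE.flow T v lam y t) = fun y => G.symm (Z t (G y)) :=
    fun t ht => funext fun y => (hsol y).2 _ (hflow y) ht
  have hd : ∀ t ∈ Icc 0 T,
      DiscODE.flowDeriv T v lam t =ᵐ[volume] deriv fun y => G.symm (Z t (G y)) := by
    intro t ht
    unfold DiscODE.flowDeriv
    rw [heq t ht]
    exact DiscODE.weakDeriv_ae_eq_of_lipschitz (hF.lipschitzWith ht)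
  have hnorm : ∀ t ∈ Icc 0 T, ∀ t' ∈ Icc 0 T, ∀ X : Set ℝ,
      eLpNorm (DiscODE.flowDeriv T v lam t - DiscODE.flowDeriv T v lam t') 1 (volume.restrict X) =
      ∫⁻ x in X, ‖deriv (fun x => G.symm (Z t (G x))) x
        - deriv (fun x => G.symm (Z t' (G x))) x‖ₑ := by
    intro t ht t' ht' X
    rw [eLpNorm_one_eq_lintegral_enorm]
    refine lintegral_congr_ae (ae_restrict_of_ae ?_)
    filter_upwards [hd t ht, hd t' ht'] with x h1 h2
    rw [Pi.sub_apply, h1, h2]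
  refine ⟨fun x₀ => ⟨hflow x₀, fun x hx t ht => ?_⟩, fun t ht => ?_, fun t' ht' K hK => ?_,
    fun hTV V L L₂ hVeq hLeq hL₂eq t ht t' ht' X hX hXb => ?_⟩
  · rw [(hsol x₀).2 x hx ht, (hsol x₀).2 _ (hflow x₀) ht]
  · have h := DiscODE.hasWeakDeriv_of_lipschitz (hF.lipschitzWith ht)
    rw [← heq t ht] at h
    exact h.weakDeriv
  · refine (hF.tendsto_lintegral_deriv_sub ht' hK).congr' ?_
    filter_upwards [self_mem_nhdsWithin] with t ht
    exact (hnorm t ht t' ht' K).symm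
  · subst hVeq hLeq hL₂eq
    have hfin := DiscODE.totalVar_lt_top hTV (DiscODE.isBounded_add_smul_Ioo hXb (V' * T * L'))
    refine ⟨hfin, ?_⟩
    rw [hnorm t ht t' ht' X]
    rw [DiscODE.totalVar_congr hvw] at hfin ⊢
    have hV := hF.V_pos
    have hL := hF.caratheodory.nonneg
    have hL₂0 : 0 ≤ L₂' := ENNReal.toReal_nonneg
    refine (hF.lintegral_deriv_sub_le ht ht' X).trans ?_
    refine (add_le_add_right (mul_le_mul_right (hF.lintegral_comp_sub_le ht ht' hX hXb
      hX.add_right (fun x hx y hy => DiscODE.mem_add_smul_Ioo hX (by positivity) hx hy) hfin.ne)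
      _) _).trans (le_of_eq ?_)
    -- Boundedness of `X` makes its measure finite, so both terms combine into one real number and
    -- the claim becomes an identity of constants.
    rw [hL₂, ← ENNReal.ofReal_toReal hXb.measure_lt_top.ne, ← ENNReal.ofReal_mul (by positivity),
      ← ENNReal.ofReal_mul (by positivity), ← ENNReal.ofReal_add (by positivity) (by positivity),
      ENNReal.toReal_ofReal ENNReal.toReal_nonneg]
    congr 1
    rw [show L₂' * V' * T = T * L₂' * V' by ring]
    ring
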